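/- **Setting.** Let $\alpha,\beta,d\in\mathbb N$ and let $\epsilon,\delta>0$. For $w:[0,1]\to\mathbb R^\beta$ put $w_\alpha=(w,\partial_xw,\dots,\partial_x^\alpha w)$, $w_\alpha^b=(w_{\alpha-1}(1),w_{\alpha-1}(0))\in\mathbb R^{2\beta\alpha}$ and $\bar w_\alpha(x)=(w_\alpha(x),w_\alpha^b)$. Let $N,N_\partial\in\mathbb R^{\beta\alpha\times\beta(\alpha+1)}$ and $N_0,N_1\in\mathbb R^{\beta\alpha\times2\beta\alpha}$ be the $0$–$1$ matrices with $w_{\alpha-1}=Nw_\alpha$, $\partial_xw_{\alpha-1}=N_\partial w_\alpha$, $w_{\alpha-1}(0)=N_0w_\alpha^b$, $w_{\alpha-1}(1)=N_1w_\alpha^b$. Let $\mathcal H^\alpha$ be the set of $w:[0,1]\to\mathbb R^\beta$ such that $w,\dots,\partial_x^{\alpha-1}w$ are absolutely continuous and $\partial_x^\alpha w\in L_2([0,1];\mathbb R^\beta)$. Given a polynomial matrix $A(x)\in\mathbb R[x]^{\beta\times\beta(\alpha+1)}$ and $F\in\mathbb R^{\beta\alpha\times2\beta\alpha}$, let $\mathcal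 B=\{w\in\mathcal H^\alpha: Fw_\alpha^b=0\}$ and consider the PDE $$\partial_tw(x,t)=A(x)w_\alpha(x,t),\qquad F w_\alpha^b=0 .\tag{1}$$ A solution of (1) is a continuous $w:[0,\infty)\to L_2([0,1];\mathbb R^\beta)$ such that, for every $t>0$, $w(\cdot,t)\in\mathcal B$ and $w$ is differentiable at $t$ in $L_2$ with derivative $A(\cdot)w_\alpha(\cdot,t)$. Write $He(Q)=\frac12(Q+Q^T)$ and $\omega(x)=x(1-x)$. Let $\Sigma^n[x]$ be the set of $n\times n$ sum-of-squares polynomial matrices, i.e. those of the form $G(x)^TG(x)$ with $G$ a (possibly non-square) polynomial matrix. Let $z(x,y)$ be the column of all monomials in $x,y$ of degree $\le d$ and, for $k\in\{0,\alpha\}$, let $Y_k(x,y)=I_{\beta(k+1)}\otimes z(x,y)$, which has $q_k=\frac12\beta(k+1)(d+1)(d+2)$ rows. *Matrices $T,R$ and kernels $\bar T,\bar R$.* Let $T_b\in\mathbb R[x]^{\beta\times\beta}$ be symmetric, $T_{12},T_{13}\in\mathbb R[x]^{\beta\times q_0}$, $T_{22},T_{33}\in\mathbb R^{q_0\times q_0}$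 symmetric and $T_{23}\in\mathbb R^{q_0\times q_0}$. Set $$T=\begin{bmatrix}T_b&T_{12}&T_{13}\\T_{12}^T&T_{22}&T_{23}\\T_{13}^T&T_{23}^T&T_{33}\end{bmatrix},$$ $$\bar T(x,y)=T_{12}(x)Y_0(x,y)+Y_0(y,x)^TT_{13}(y)^T+\int_0^yY_0(z,x)^TT_{33}Y_0(z,y)dz+\int_y^xY_0(z,x)^TT_{23}^TY_0(z,y)dz+\int_x^1Y_0(z,x)^TT_{22}Y_0(z,y)dz .$$ Let $R_b\in\mathbb R[x]^{\beta(3\alpha+1)\times\beta(3\alpha+1)}$ be symmetric, $R_{12},R_{13}\in\mathbb R[x]^{\beta(\alpha+1)\times q_\alpha}$, $R_{22},R_{33}\in\mathbb R^{q_\alpha\times q_\alpha}$ symmetric and $R_{23}\in\mathbb R^{q_\alpha\times q_\alpha}$. Let $\bar R(x,y)$ be given by the same formula with $R_{ij},Y_\alpha$ in place of $T_{ij},Y_0$, and $$R=\begin{bmatrix}R_b&\hat R_{12}&\hat R_{13}\\\hat R_{12}^T&R_{22}&R_{23}\\\hat R_{13}^T&R_{23}^T&R_{33}\end{bmatrix},\qquad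 \hat R_{1j}=\begin{bmatrix}R_{1j}\\0_{2\beta\alpha,q_\alpha}\end{bmatrix}.$$ With $\Gamma[K](x,y)=K(x,y)$ for $x\ge y$ and $\Gamma[K](x,y)=K(y,x)^T$ for $y>x$, these matrices define the quadratic functionals $$\mathcal T(w)=\int_0^1w^TT_bw\,dx+\int_0^1\!\!\int_0^1w(x)^T\Gamma[\bar T]w(y)\,dy\,dx,\qquad \mathcal R(w)=\int_0^1\bar w_\alpha^TR_b\bar w_\alpha\,dx+\int_0^1\!\!\int_0^1w_\alpha(x)^T\Gamma[\bar R]w_\alpha(y)\,dy\,dx .$$ *Matrices $U_b,\bar U$.* Here and below $0$ denotes zero blocks of the sizes that make the left-hand sides $\beta(3\alpha+1)\times\beta(3\alpha+1)$ (for $U_b,K_b,H_b,B_b$) or $\beta(\alpha+1)\times\beta(\alpha+1)$ (for $\bar U,\bar H$): $$U_b=-He\begin{bmatrix}T_bA&0\\0&0\end{bmatrix}-He\begin{bmatrix}\delta T_b&0\\0&0\end{bmatrix},$$ $$\bar U(x,y)=-\frac12\left(\begin{bmatrix}\bar T(x,y)^TA(x)\\0\end{bmatrix}^T+\begin{bmatrix}\bar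 T(x,y)A(y)\\0\end{bmatrix}\right)-\frac12\begin{bmatrix}2\delta\bar T(x,y)&0\\0&0\end{bmatrix}.$$ *Slack matrices.* For polynomial matrices $K_1\in\mathbb R[x]^{\beta\alpha\times\beta\alpha}$, $K_2\in\mathbb R[x]^{\beta\alpha\times2\beta\alpha}$, $H_1,H_2\in\mathbb R[x,y]^{\beta\alpha\times\beta\alpha}$, $B_1\in\mathbb R[x]^{\beta(\alpha+1)\times\beta\alpha}$, $B_2\in\mathbb R[x]^{2\beta\alpha\times\beta\alpha}$ let $$K_b=\begin{bmatrix}N^TK_1'N+N^TK_1N_\partial+N_\partial^TK_1N& N_\partial^TK_2+N^TK_2'\\0&N_0^TK_1(0)N_0-N_1^TK_1(1)N_1+N_0^TK_2(0)-N_1^TK_2(1)\end{bmatrix},$$ $$H_b(x)=\begin{bmatrix}-N^T(H_1(x,x)+H_2(x,x))N&N^TH_1(x,0)N_0\\N_1^TH_2(1,x)N&0\end{bmatrix},\qquad B_b=\begin{bmatrix}0&B_1F\\0&B_2F\end{bmatrix},$$ $$\bar H(x,y)=\tfrac12N^T(\partial_yH_1-\partial_xH_2)N+\tfrac12(N^TH_1N_\partial-N_\partial^TH_2N).$$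 **Theorem.** Suppose that there exist such matrices $T_b,T_{ij},R_b,R_{ij},K_i,H_i,B_i$ and symmetric polynomial matrices $S_T\in\mathbb R[x]^{(\beta+2q_0)\times(\beta+2q_0)}$, $S_R\in\mathbb R[x]^{(\beta(3\alpha+1)+2q_\alpha)\times(\beta(3\alpha+1)+2q_\alpha)}$, $S\in\mathbb R[x]^{\beta(3\alpha+1)\times\beta(3\alpha+1)}$ with $$T-\operatorname{diag}(\epsilon I_\beta,0_{2q_0})-\omega S_T\in\Sigma^{\beta+2q_0}[x],\qquad S_T\in\Sigma^{\beta+2q_0}[x],$$ $$R-\omega S_R\in\Sigma^{\beta(3\alpha+1)+2q_\alpha}[x],\qquad S_R\in\Sigma^{\beta(3\alpha+1)+2q_\alpha}[x],$$ $$He(U_b+K_b+H_b+B_b)-R_b-\omega S\in\Sigma^{\beta(3\alpha+1)}[x],\qquad S\in\Sigma^{\beta(3\alpha+1)}[x],$$ $$\bar U(x,y)+\bar H(x,y)-\bar R(x,y)=0\quad\text{for all }x,y .$$ Then (1) is exponentially stable in $L_2$ with rate $\delta$: there is a constant $\kappa>0$ such that every solution $w$ of (1) satisfies $$\|w(\cdot,t)\|_{L_2}\le\kappa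 e^{-\delta t}\|w(\cdot,0)\|_{L_2}\qquad\text{for all }t\ge0 .$$ -/

import Mathlib

open Polynomial MeasureTheory Set Matrix

namespace PolyPDE

noncomputable section

/-! ### Index types, projections and the monomial matrix -/

/-- Coordinates of `w_{k-1} = (w, ∂ₓw, …, ∂ₓ^{k-1} w)` for an `ℝ^β`-valued function `w`:
the pair `(i, b)` is the `b`-th coordinate of `∂ₓ^i w`. -/
abbrev JetIdx (k β : ℕ) : Type := Fin k × Fin β

/-- Coordinates of the boundary vector `w_α^b = (w_{α-1}(1), w_{α-1}(0))`:
`Sum.inl` is the value at `1`, `Sum.inr` the value at `0`. -/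
abbrev BdIdx (α β : ℕ) : Type := JetIdx α β ⊕ JetIdx α β

/-- Coordinates of `w̄_α(x) = (w_α(x), w_α^b)`. -/
abbrev BarIdx (α β : ℕ) : Type := JetIdx (α + 1) β ⊕ BdIdx α β

/-- Monomials `x^a y^b` of total degree at most `d`. -/
abbrev MonIdx (d : ℕ) : Type := {p : Fin (d + 1) × Fin (d + 1) // p.1.val + p.2.val ≤ d}

/-- `N`, with `w_{α-1}(x) = N w_α(x)`. -/
def projN (R : Type) [CommRing R] (α β : ℕ) : Matrix (JetIdx α β) (JetIdx (α + 1) β) R :=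
  Matrix.of fun p j => if j = (p.1.castSucc, p.2) then 1 else 0

/-- `N_∂`, with `∂ₓ w_{α-1}(x) = N_∂ w_α(x)`. -/
def projNd (R : Type) [CommRing R] (α β : ℕ) : Matrix (JetIdx α β) (JetIdx (α + 1) β) R :=
  Matrix.of fun p j => if j = (p.1.succ, p.2) then 1 else 0

/-- `N₀`, with `w_{α-1}(0) = N₀ w_α^b`. -/
def projN0 (R : Type) [CommRing R] (α β : ℕ) : Matrix (JetIdx α β) (BdIdx α β) R :=
  Matrix.fromCols 0 1

/-- `N₁`, with `w_{α-1}(1) = N₁ w_α^b`. -/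
def projN1 (R : Type) [CommRing R] (α β : ℕ) : Matrix (JetIdx α β) (BdIdx α β) R :=
  Matrix.fromCols 1 0

/-- `Y(x,y) = I ⊗ z(x,y)`, where `z(x,y)` is the column of the monomials in `x, y` of degree at
most `d`. -/
def monY (ι : Type) [DecidableEq ι] (d : ℕ) (x y : ℝ) : Matrix (ι × MonIdx d) ι ℝ :=
  Matrix.of fun p j => if p.1 = j then x ^ p.2.val.1.val * y ^ p.2.val.2.val else 0

/-- `He(Q) = (Q + Qᵀ) / 2` for polynomial matrices. -/
def He {n : Type} (Q : Matrix n n ℝ[X]) : Matrix n n ℝ[X] := (1 / 2 : ℝ) • (Q + Qᵀ)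

/-- The univariate polynomial matrix `M` is a sum of squares: `M(x) = ∑ₖ gₖ(x) gₖ(x)ᵀ` for finitely
many polynomial vectors `gₖ` (the rows of `G`). -/
def IsSOS {n : Type} (M : Matrix n n ℝ[X]) : Prop :=
  ∃ (r : ℕ) (G : Matrix (Fin r) n ℝ[X]), M = Gᵀ * G

/-- `ω(x) = x (1 - x)`. -/
def omega : ℝ[X] := X * (1 - X)

/-- Value at `x` of a univariate polynomial matrix. -/
def evalMat {m n : Type} (M : Matrix m n ℝ[X]) (x : ℝ) : Matrix m n ℝ := M.map (Polynomial.eval x)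

/-- Value at `(x, y)` of a bivariate polynomial matrix (variable `0` is `x`, variable `1` is `y`). -/
def evalMat₂ {m n : Type} (M : Matrix m n (MvPolynomial (Fin 2) ℝ)) (x y : ℝ) : Matrix m n ℝ :=
  M.map (MvPolynomial.eval ![x, y])

/-- Substitution `x := p`, `y := q` in a bivariate polynomial matrix, for univariate `p, q`. -/
def substMat {m n : Type} (M : Matrix m n (MvPolynomial (Fin 2) ℝ)) (p q : ℝ[X]) :
    Matrix m n ℝ[X] :=
  M.map (MvPolynomial.aeval ![p, q])

/-! ### The matrices `T`, `R` and the kernels `T̄`, `R̄` -/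

/-- The symmetric block matrix
`[[Pb, P12, P13], [P12ᵀ, P22, P23], [P13ᵀ, P23ᵀ, P33]]`. -/
def blockMat {ν κ : Type} (Pb : Matrix ν ν ℝ[X]) (P12 P13 : Matrix ν κ ℝ[X])
    (P22 P23 P33 : Matrix κ κ ℝ) : Matrix (ν ⊕ (κ ⊕ κ)) (ν ⊕ (κ ⊕ κ)) ℝ[X] :=
  Matrix.fromBlocks Pb (Matrix.fromCols P12 P13) (Matrix.fromRows P12ᵀ P13ᵀ)
    (Matrix.fromBlocks (P22.map C) (P23.map C) (P23ᵀ.map C) (P33.map C))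

/-- `T(x)`. -/
def matT {β d : ℕ} (Tb : Matrix (Fin β) (Fin β) ℝ[X])
    (T12 T13 : Matrix (Fin β) (Fin β × MonIdx d) ℝ[X])
    (T22 T23 T33 : Matrix (Fin β × MonIdx d) (Fin β × MonIdx d) ℝ) :=
  blockMat Tb T12 T13 T22 T23 T33

/-- The block matrix `diag(ε I_β, 0, 0)`. -/
def matEps (β d : ℕ) (ε : ℝ) :
    Matrix (Fin β ⊕ ((Fin β × MonIdx d) ⊕ (Fin β × MonIdx d)))
      (Fin β ⊕ ((Fin β × MonIdx d) ⊕ (Fin β × MonIdx d))) ℝ[X] :=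
  Matrix.fromBlocks (ε • (1 : Matrix (Fin β) (Fin β) ℝ[X])) 0 0 0

/-- `R(x)`: here `R12`, `R13` are padded with `2βα` zero rows. -/
def matR {α β d : ℕ} (Rb : Matrix (BarIdx α β) (BarIdx α β) ℝ[X])
    (R12 R13 : Matrix (JetIdx (α + 1) β) (JetIdx (α + 1) β × MonIdx d) ℝ[X])
    (R22 R23 R33 : Matrix (JetIdx (α + 1) β × MonIdx d) (JetIdx (α + 1) β × MonIdx d) ℝ) :=
  blockMat Rb (Matrix.fromRows R12 (0 : Matrix (BdIdx α β) _ ℝ[X]))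
    (Matrix.fromRows R13 (0 : Matrix (BdIdx α β) _ ℝ[X])) R22 R23 R33

/-- Entrywise integral `∫ₐᵇ M(z) dz` of a matrix-valued function. -/
def matIntegral {m n : Type} (M : ℝ → Matrix m n ℝ) (a b : ℝ) : Matrix m n ℝ :=
  Matrix.of fun i j => ∫ z in a..b, M z i j

/-- The kernel
`P12(x) Y(x,y) + Y(y,x)ᵀ P13(y)ᵀ + ∫₀^y Y(z,x)ᵀ P33 Y(z,y) dz + ∫_y^x Y(z,x)ᵀ P23ᵀ Y(z,y) dz
  + ∫_x^1 Y(z,x)ᵀ P22 Y(z,y) dz`,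
which gives both `T̄` and `R̄`. -/
def kernel {ι : Type} [Fintype ι] [DecidableEq ι] {d : ℕ}
    (P12 P13 : Matrix ι (ι × MonIdx d) ℝ[X])
    (P22 P23 P33 : Matrix (ι × MonIdx d) (ι × MonIdx d) ℝ) (x y : ℝ) : Matrix ι ι ℝ :=
  evalMat P12 x * monY ι d x y + (monY ι d y x)ᵀ * (evalMat P13 y)ᵀ
    + matIntegral (fun z => (monY ι d z x)ᵀ * P33 * monY ι d z y) 0 y
    + matIntegral (fun z => (monY ι d z x)ᵀ * P23ᵀ * monY ι d z y) y x
    + matIntegral (fun z => (monY ι d z x)ᵀ * P22 * monY ι d z y) x 1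

/-! ### The matrices `U_b`, `Ū` of the derivative of the Lyapunov functional -/

/-- `[M; 0]`: extend `M`, which has `β` rows, by `βα` zero rows. -/
def padRows {R : Type} [CommRing R] (α : ℕ) {β : ℕ} {n : Type} (M : Matrix (Fin β) n R) :
    Matrix (JetIdx (α + 1) β) n R :=
  Matrix.of fun p j => if p.1 = 0 then M p.2 j else 0

/-- `[M, 0; 0, 0]`: extend the `β × β` matrix `M` by `βα` zero rows and columns. -/
def padSquare {R : Type} [CommRing R] (α : ℕ) {β : ℕ} (M : Matrix (Fin β) (Fin β) R) :
    Matrix (JetIdx (α + 1) β) (JetIdx (α + 1) β) R :=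
  Matrix.of fun p q => if p.1 = 0 ∧ q.1 = 0 then M p.2 q.2 else 0

/-- `U_b(x)`. -/
def matUb {α β : ℕ} (A : Matrix (Fin β) (JetIdx (α + 1) β) ℝ[X]) (δ : ℝ)
    (Tb : Matrix (Fin β) (Fin β) ℝ[X]) : Matrix (BarIdx α β) (BarIdx α β) ℝ[X] :=
  -He (Matrix.fromBlocks (padRows α (Tb * A)) 0 0 0)
    - He (Matrix.fromBlocks (padSquare α (δ • Tb)) 0 0 0)

/-- `Ū(x,y)`, for a given kernel `T̄`. -/
def matUbar {α β : ℕ} (A : Matrix (Fin β) (JetIdx (α + 1) β) ℝ[X]) (δ : ℝ)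
    (Tbar : ℝ → ℝ → Matrix (Fin β) (Fin β) ℝ) (x y : ℝ) :
    Matrix (JetIdx (α + 1) β) (JetIdx (α + 1) β) ℝ :=
  -((1 / 2 : ℝ) • ((padRows α ((Tbar x y)ᵀ * evalMat A x))ᵀ
      + padRows α (Tbar x y * evalMat A y)))
    - (1 / 2 : ℝ) • padSquare α ((2 * δ) • Tbar x y)

/-! ### The slack matrices `K_b`, `H_b`, `H̄`, `B_b` -/

/-- `K_b(x)`. -/
def matKb {α β : ℕ} (K1 : Matrix (JetIdx α β) (JetIdx α β) ℝ[X])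
    (K2 : Matrix (JetIdx α β) (BdIdx α β) ℝ[X]) : Matrix (BarIdx α β) (BarIdx α β) ℝ[X] :=
  let N := projN ℝ[X] α β
  let Nd := projNd ℝ[X] α β
  let N0 := projN0 ℝ α β
  let N1 := projN1 ℝ α β
  Matrix.fromBlocks
    (Nᵀ * K1.map derivative * N + Nᵀ * K1 * Nd + Ndᵀ * K1 * N)
    (Ndᵀ * K2 + Nᵀ * K2.map derivative)
    0
    ((N0ᵀ * evalMat K1 0 * N0 - N1ᵀ * evalMat K1 1 * N1
      + N0ᵀ * evalMat K2 0 - N1ᵀ * evalMat K2 1).map C)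

/-- `H_b(x)`. -/
def matHb {α β : ℕ} (H1 H2 : Matrix (JetIdx α β) (JetIdx α β) (MvPolynomial (Fin 2) ℝ)) :
    Matrix (BarIdx α β) (BarIdx α β) ℝ[X] :=
  let N := projN ℝ[X] α β
  let N0 := projN0 ℝ[X] α β
  let N1 := projN1 ℝ[X] α β
  Matrix.fromBlocks
    (-(Nᵀ * (substMat H1 X X + substMat H2 X X) * N))
    (Nᵀ * substMat H1 X 0 * N0)
    (N1ᵀ * substMat H2 1 X * N)
    0

/-- `H̄(x,y)`. -/
def matHbar {α β : ℕ} (H1 H2 : Matrix (JetIdx α β) (JetIdx α β) (MvPolynomial (Fin 2) ℝ))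
    (x y : ℝ) : Matrix (JetIdx (α + 1) β) (JetIdx (α + 1) β) ℝ :=
  let N := projN ℝ α β
  let Nd := projNd ℝ α β
  (1 / 2 : ℝ) • (Nᵀ * (evalMat₂ (H1.map (MvPolynomial.pderiv 1)) x y
      - evalMat₂ (H2.map (MvPolynomial.pderiv 0)) x y) * N)
    + (1 / 2 : ℝ) • (Nᵀ * evalMat₂ H1 x y * Nd - Ndᵀ * evalMat₂ H2 x y * N)

/-- `B_b(x)`. -/
def matBb {α β : ℕ} (F : Matrix (JetIdx α β) (BdIdx α β) ℝ)
    (B1 : Matrix (JetIdx (α + 1) β) (JetIdx α β) ℝ[X])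
    (B2 : Matrix (BdIdx α β) (JetIdx α β) ℝ[X]) : Matrix (BarIdx α β) (BarIdx α β) ℝ[X] :=
  Matrix.fromBlocks 0 (B1 * F.map C) 0 (B2 * F.map C)

/-! ### Function spaces, the PDE and exponential stability -/

/-- Lebesgue measure on `[0,1]`. -/
abbrev μI : Measure ℝ := volume.restrict (Icc (0 : ℝ) 1)

/-- `L₂([0,1]; ℝ^β)`, with the Euclidean norm on `ℝ^β`. -/
abbrev L2 (β : ℕ) : Type := Lp (EuclideanSpace ℝ (Fin β)) 2 μI

/-- `∂ₓ^i w` on `[0,1]` (one-sided at the end points). -/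
def dx {β : ℕ} (i : ℕ) (w : ℝ → EuclideanSpace ℝ (Fin β)) : ℝ → EuclideanSpace ℝ (Fin β) :=
  iteratedDerivWithin i w (Icc (0 : ℝ) 1)

/-- `w ∈ ℋ^α([0,1]; ℝ^β)`: the derivatives of order `i < α` exist on `[0,1]` and are absolutely
continuous, and `∂ₓ^α w` is square integrable. Only the values of `w` on `[0,1]` matter. -/
structure MemH {β : ℕ} (α : ℕ) (w : ℝ → EuclideanSpace ℝ (Fin β)) : Prop where
  differentiableOn : ∀ i : ℕ, i + 1 < α → DifferentiableOn ℝ (dx i w) (Icc 0 1)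
  absolutelyContinuous : ∀ i : ℕ, i < α → AbsolutelyContinuousOnInterval (dx i w) 0 1
  memLp : MemLp (dx α w) 2 μI

/-- `(w, ∂ₓw, …, ∂ₓ^{k-1} w)(x)`; thus `jet (α + 1) w x` is `w_α(x)`. -/
def jet {β : ℕ} (k : ℕ) (w : ℝ → EuclideanSpace ℝ (Fin β)) (x : ℝ) : JetIdx k β → ℝ :=
  fun p => dx p.1.val w x p.2

/-- `w_α^b = (w_{α-1}(1), w_{α-1}(0))`. -/
def bdVec {β : ℕ} (α : ℕ) (w : ℝ → EuclideanSpace ℝ (Fin β)) : BdIdx α β → ℝ :=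
  Sum.elim (jet α w 1) (jet α w 0)

/-- `w ∈ ℬ`: `w ∈ ℋ^α` and `F w_α^b = 0`. -/
def MemB {α β : ℕ} (F : Matrix (JetIdx α β) (BdIdx α β) ℝ)
    (w : ℝ → EuclideanSpace ℝ (Fin β)) : Prop :=
  MemH α w ∧ F *ᵥ bdVec α w = 0

/-- `u` is a (classical, `L₂`-valued) solution on `[0,∞)` of `∂ₜ w = A(x) w_α` with boundary
conditions `F w_α^b = 0`: it is continuous into `L₂`, and at each `t > 0` the state `u t` is
(the class of) some `w ∈ ℬ`, and `u` is differentiable in `L₂` with derivative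
`x ↦ A(x) w_α(x)`. -/
structure IsSolution {α β : ℕ} (A : Matrix (Fin β) (JetIdx (α + 1) β) ℝ[X])
    (F : Matrix (JetIdx α β) (BdIdx α β) ℝ) (u : ℝ → L2 β) : Prop where
  continuousOn : ContinuousOn u (Ici 0)
  equation : ∀ t : ℝ, 0 < t → ∃ (w : ℝ → EuclideanSpace ℝ (Fin β)) (v : L2 β),
    MemB F w ∧ (∀ᵐ x ∂μI, u t x = w x) ∧ HasDerivAt u v t ∧
      ∀ᵐ x ∂μI, v x = WithLp.toLp 2 (evalMat A x *ᵥ jet (α + 1) w x)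

/-- Exponential stability in `L₂` with decay rate `δ`: one constant `κ` serves all solutions. -/
def ExpStable {α β : ℕ} (A : Matrix (Fin β) (JetIdx (α + 1) β) ℝ[X])
    (F : Matrix (JetIdx α β) (BdIdx α β) ℝ) (δ : ℝ) : Prop :=
  ∃ κ : ℝ, 0 < κ ∧ ∀ u : ℝ → L2 β, IsSolution A F u →
    ∀ t : ℝ, 0 ≤ t → ‖u t‖ ≤ κ * Real.exp (-δ * t) * ‖u 0‖

end

end PolyPDE

open PolyPDE

/-! The functional `𝒯` is a Lyapunov function equivalent to the squared `L₂` norm. Polarised, it is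
the symmetric form `lyapunovForm`, which extends to a bounded bilinear form `q` on `L₂`
(`exists_lyapunovForm_continuous`). Coercivity `ε ‖f‖² ≤ q f f` is `lyapunovForm_coercive`. With `V
t = q (u t) (u t)`, symmetry gives `V' = 2 q(u, A w_α)`, so `lyapunovForm_dissipation` says `V' ≤
-2δ V`. Hence `exp (2δt) V t` is nonincreasing, and comparing its values at `t` and `0` through the
two norm bounds gives the decay.

Two mechanisms are behind this. The first turns matrix positivity into positivity of integral
functionals. A certificate `M - ω S = GᵀG` with `S` a sum of squares makes `M(x)` positive
semidefinite on `[0,1]`. Applying `M` to the vector made of the state, `z ↦ ∫₀^z Y(z,x) f(x) dx` and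
`z ↦ ∫_z^1 Y(z,x) f(x) dx`, then using Fubini and folding the square along its diagonal, produces
exactly a multiplier term plus the kernel term (`integral_blockMat_eq`). This serves both `𝒯` and
`ℛ`.

The second mechanism is integration by parts. The matrices `U_b`, `Ū` represent `-(q(w, A w_α) + δ
q(w, w))` in terms of `w̄_α`. To this one may add forms vanishing on `ℬ`: `K_b` is a total
derivative with its boundary values subtracted (`integral_matKb`), `H_b` and `H̄` are the boundary
and interior parts of a divergence on the triangle `y ≤ x` (`integral_matHb`), and `B_b` vanishes by
the boundary conditions. The constraints say that the sum dominates `ℛ(w)`, which is nonnegative. -/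

namespace PolyPDE

noncomputable section

/-! ### Evaluation of polynomial matrices and quadratic forms -/

section Eval

variable {l m n : Type}

@[simp] lemma evalMat_apply (M : Matrix m n ℝ[X]) (x : ℝ) (i : m) (j : n) :
    evalMat M x i j = (M i j).eval x := rfl

lemma evalMat_add (M M' : Matrix m n ℝ[X]) (x : ℝ) :
    evalMat (M + M') x = evalMat M x + evalMat M' x := by
  ext; simp

lemma evalMat_sub (M M' : Matrix m n ℝ[X]) (x : ℝ) :
    evalMat (M - M') x = evalMat M x - evalMat M' x := by
  ext; simp

lemma evalMat_neg (M : Matrix m n ℝ[X]) (x : ℝ) : evalMat (-M) x = -evalMat M x := by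
  ext; simp

lemma evalMat_smul (p : ℝ[X]) (M : Matrix m n ℝ[X]) (x : ℝ) :
    evalMat (p • M) x = p.eval x • evalMat M x := by
  ext; simp

lemma evalMat_real_smul (c : ℝ) (M : Matrix m n ℝ[X]) (x : ℝ) :
    evalMat (c • M) x = c • evalMat M x := by
  ext; simp

lemma evalMat_transpose (M : Matrix m n ℝ[X]) (x : ℝ) : evalMat Mᵀ x = (evalMat M x)ᵀ := rfl

lemma evalMat_zero (x : ℝ) : evalMat (0 : Matrix m n ℝ[X]) x = 0 := by
  ext; simp

lemma evalMat_mul [Fintype m] (M : Matrix l m ℝ[X]) (M' : Matrix m n ℝ[X]) (x : ℝ) :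
    evalMat (M * M') x = evalMat M x * evalMat M' x := by
  ext; simp [Matrix.mul_apply, eval_finsetSum]

lemma evalMat_map_C (M : Matrix m n ℝ) (x : ℝ) : evalMat (M.map C) x = M := by
  ext; simp

lemma evalMat_fromBlocks {o : Type} (A : Matrix n l ℝ[X]) (B : Matrix n m ℝ[X])
    (C : Matrix o l ℝ[X]) (D : Matrix o m ℝ[X]) (x : ℝ) :
    evalMat (fromBlocks A B C D) x
      = fromBlocks (evalMat A x) (evalMat B x) (evalMat C x) (evalMat D x) :=
  fromBlocks_map ..

lemma evalMat_fromRows (A : Matrix l n ℝ[X]) (B : Matrix m n ℝ[X]) (x : ℝ) :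
    evalMat (fromRows A B) x = fromRows (evalMat A x) (evalMat B x) := by
  ext (i | i) j <;> rfl

lemma evalMat_fromCols (A : Matrix n l ℝ[X]) (B : Matrix n m ℝ[X]) (x : ℝ) :
    evalMat (fromCols A B) x = fromCols (evalMat A x) (evalMat B x) := by
  ext i (j | j) <;> rfl

lemma continuous_evalMat (M : Matrix m n ℝ[X]) (i : m) (j : n) :
    Continuous fun x => evalMat M x i j :=
  (M i j).continuous

lemma IsSOS.nonneg [Fintype n] {M : Matrix n n ℝ[X]} (h : IsSOS M) (x : ℝ) (v : n → ℝ) :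
    0 ≤ v ⬝ᵥ evalMat M x *ᵥ v := by
  obtain ⟨r, G, rfl⟩ := h
  rw [evalMat_mul, evalMat_transpose, ← mulVec_mulVec, dotProduct_mulVec, vecMul_transpose]
  exact Finset.sum_nonneg fun i _ => mul_self_nonneg _

lemma omega_nonneg {x : ℝ} (hx : x ∈ Icc (0 : ℝ) 1) : 0 ≤ omega.eval x := by
  simpa [omega] using mul_nonneg hx.1 (sub_nonneg.2 hx.2)

/-- On `[0,1]` the weight `ω` is nonnegative, so `M = GᵀG + ω S` is a sum of two positive
semidefinite matrices there. The certificate is local: nothing is claimed outside the interval. -/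
lemma dotProduct_nonneg_of_isSOS_sub [Fintype n] {M S : Matrix n n ℝ[X]}
    (h : IsSOS (M - omega • S)) (hS : IsSOS S) {x : ℝ} (hx : x ∈ Icc (0 : ℝ) 1) (v : n → ℝ) :
    0 ≤ v ⬝ᵥ evalMat M x *ᵥ v := by
  have h1 := h.nonneg x v
  rw [evalMat_sub, evalMat_smul, sub_mulVec, smul_mulVec, dotProduct_sub, dotProduct_smul,
    smul_eq_mul] at h1
  have := mul_nonneg (omega_nonneg hx) (hS.nonneg x v)
  linarith

lemma dotProduct_transpose_mulVec [Fintype m] [Fintype n] (M : Matrix m n ℝ) (u : n → ℝ)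
    (v : m → ℝ) : u ⬝ᵥ Mᵀ *ᵥ v = v ⬝ᵥ M *ᵥ u := by
  rw [mulVec_transpose, ← dotProduct_comm, dotProduct_mulVec]

/-- A quadratic form only sees the symmetric part, so `He` can be dropped in every computation
below. -/
lemma dotProduct_evalMat_He [Fintype n] (Q : Matrix n n ℝ[X]) (x : ℝ) (v : n → ℝ) :
    v ⬝ᵥ evalMat (He Q) x *ᵥ v = v ⬝ᵥ evalMat Q x *ᵥ v := by
  rw [He, evalMat_real_smul, evalMat_add, evalMat_transpose, smul_mulVec, add_mulVec,
    dotProduct_smul, dotProduct_add, dotProduct_transpose_mulVec, smul_eq_mul]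
  ring

lemma sumElim_dotProduct_fromBlocks [Fintype l] [Fintype m] (A : Matrix l l ℝ) (B : Matrix l m ℝ)
    (C : Matrix m l ℝ) (D : Matrix m m ℝ) (u : l → ℝ) (v : m → ℝ) :
    Sum.elim u v ⬝ᵥ fromBlocks A B C D *ᵥ Sum.elim u v
      = u ⬝ᵥ A *ᵥ u + u ⬝ᵥ B *ᵥ v + v ⬝ᵥ C *ᵥ u + v ⬝ᵥ D *ᵥ v := by
  rw [fromBlocks_mulVec, sumElim_dotProduct_sumElim]
  simp only [Sum.elim_comp_inl, Sum.elim_comp_inr, dotProduct_add]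
  ring

lemma dotProduct_evalMat_blockMat {ν κ : Type} [Fintype ν] [Fintype κ] (Pb : Matrix ν ν ℝ[X])
    (P12 P13 : Matrix ν κ ℝ[X]) (P22 P23 P33 : Matrix κ κ ℝ) (x : ℝ) (u : ν → ℝ) (v w : κ → ℝ) :
    Sum.elim u (Sum.elim v w) ⬝ᵥ evalMat (blockMat Pb P12 P13 P22 P23 P33) x
        *ᵥ Sum.elim u (Sum.elim v w)
      = u ⬝ᵥ evalMat Pb x *ᵥ u + 2 * (u ⬝ᵥ evalMat P12 x *ᵥ v) + 2 * (u ⬝ᵥ evalMat P13 x *ᵥ w)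
        + v ⬝ᵥ P22 *ᵥ v + 2 * (v ⬝ᵥ P23 *ᵥ w) + w ⬝ᵥ P33 *ᵥ w := by
  rw [blockMat, evalMat_fromBlocks, evalMat_fromBlocks, evalMat_fromRows, evalMat_fromCols,
    sumElim_dotProduct_fromBlocks, sumElim_dotProduct_fromBlocks]
  simp only [evalMat_map_C, evalMat_transpose, fromCols_mulVec, fromRows_mulVec,
    sumElim_dotProduct_sumElim, dotProduct_add, dotProduct_transpose_mulVec, Sum.elim_comp_inl,
    Sum.elim_comp_inr]
  ring

end Eval

/-! ### Integrability on the unit interval and the unit square -/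

/-- Total mass one makes constants integrable, embeds `L₂` in `L₁`, and gives this embedding norm at
most one. -/
instance : IsProbabilityMeasure μI := ⟨by simp⟩

/-- Lebesgue measure on the triangle `{(x, y) | 0 ≤ y ≤ x ≤ 1}`. -/
abbrev μTri : Measure (ℝ × ℝ) := (μI.prod μI).restrict {p | p.2 ≤ p.1}

lemma measurableSet_tri : MeasurableSet {p : ℝ × ℝ | p.2 ≤ p.1} :=
  measurableSet_le measurable_snd measurable_fst

lemma ae_mem_Icc : ∀ᵐ x ∂μI, x ∈ Icc (0 : ℝ) 1 := ae_restrict_mem measurableSet_Icc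

lemma ae_prod_mem_Icc : ∀ᵐ p ∂(μI.prod μI), p.1 ∈ Icc (0 : ℝ) 1 ∧ p.2 ∈ Icc (0 : ℝ) 1 := by
  rw [Measure.prod_restrict]
  filter_upwards [ae_restrict_mem (measurableSet_Icc.prod measurableSet_Icc)] with p hp using hp

lemma exists_ae_bound {k : ℝ → ℝ} (hk : Continuous k) : ∃ c, ∀ᵐ x ∂μI, ‖k x‖ ≤ c := by
  obtain ⟨c, hc⟩ := isCompact_Icc.exists_bound_of_continuousOn (s := Icc (0 : ℝ) 1)
    hk.continuousOn
  exact ⟨c, ae_mem_Icc.mono hc⟩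

lemma exists_ae_prod_bound {k : ℝ → ℝ → ℝ} (hk : Continuous fun p : ℝ × ℝ => k p.1 p.2) :
    ∃ c, ∀ᵐ p ∂(μI.prod μI), ‖k p.1 p.2‖ ≤ c := by
  obtain ⟨c, hc⟩ := (isCompact_Icc.prod isCompact_Icc).exists_bound_of_continuousOn
    (s := Icc (0 : ℝ) 1 ×ˢ Icc (0 : ℝ) 1) hk.continuousOn
  exact ⟨c, ae_prod_mem_Icc.mono fun p hp => hc p hp⟩

lemma integrable_mul_mul {f g k : ℝ → ℝ} (hf : MemLp f 2 μI) (hg : MemLp g 2 μI)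
    (hk : Continuous k) : Integrable (fun x => f x * (k x * g x)) μI := by
  obtain ⟨c, hc⟩ := exists_ae_bound hk
  exact ((hf.integrable_mul hg).bdd_mul hk.aestronglyMeasurable hc).congr
    (.of_forall fun x => by simp only [Pi.mul_apply]; ring)

lemma integrable_prod_mul_mul {f g : ℝ → ℝ} {k : ℝ → ℝ → ℝ} (hf : Integrable f μI)
    (hg : Integrable g μI) (hk : Continuous fun p : ℝ × ℝ => k p.1 p.2) :
    Integrable (fun p : ℝ × ℝ => f p.1 * (k p.1 p.2 * g p.2)) (μI.prod μI) := by
  obtain ⟨c, hc⟩ := exists_ae_prod_bound hk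
  exact ((hf.mul_prod hg).bdd_mul hk.aestronglyMeasurable hc).congr
    (.of_forall fun x => by ring)

section Quad

variable {m n : Type} [Fintype m] [Fintype n]

lemma dotProduct_mulVec_eq_sum (M : Matrix m n ℝ) (u : m → ℝ) (v : n → ℝ) :
    u ⬝ᵥ M *ᵥ v = ∑ i, ∑ j, u i * (M i j * v j) := by
  simp [dotProduct, mulVec, Finset.mul_sum]

lemma integrable_dotProduct_mulVec {f : ℝ → m → ℝ} {g : ℝ → n → ℝ} {M : ℝ → Matrix m n ℝ}
    (hf : MemLp f 2 μI) (hg : MemLp g 2 μI) (hM : ∀ i j, Continuous fun x => M x i j) :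
    Integrable (fun x => f x ⬝ᵥ M x *ᵥ g x) μI := by
  simp_rw [dotProduct_mulVec_eq_sum]
  exact integrable_finsetSum _ fun i _ => integrable_finsetSum _ fun j _ =>
    integrable_mul_mul (hf.eval i) (hg.eval j) (hM i j)

lemma integrable_prod_dotProduct_mulVec {f : ℝ → m → ℝ} {g : ℝ → n → ℝ}
    {K : ℝ → ℝ → Matrix m n ℝ} (hf : MemLp f 2 μI) (hg : MemLp g 2 μI)
    (hK : ∀ i j, Continuous fun p : ℝ × ℝ => K p.1 p.2 i j) :
    Integrable (fun p : ℝ × ℝ => f p.1 ⬝ᵥ K p.1 p.2 *ᵥ g p.2) (μI.prod μI) := by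
  simp_rw [dotProduct_mulVec_eq_sum]
  exact integrable_finsetSum _ fun i _ => integrable_finsetSum _ fun j _ =>
    integrable_prod_mul_mul ((hf.eval i).integrable (by norm_num))
      ((hg.eval j).integrable (by norm_num)) (k := fun x y => K x y i j) (hK i j)

lemma integrable_tri_dotProduct_mulVec {f : ℝ → m → ℝ} {g : ℝ → n → ℝ}
    {K : ℝ → ℝ → Matrix m n ℝ} (hf : MemLp f 2 μI) (hg : MemLp g 2 μI)
    (hK : ∀ i j, Continuous fun p : ℝ × ℝ => K p.1 p.2 i j) :
    Integrable (fun p : ℝ × ℝ => f p.1 ⬝ᵥ K p.1 p.2 *ᵥ g p.2) μTri :=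
  (integrable_prod_dotProduct_mulVec hf hg hK).restrict

end Quad

/-! ### The kernel of a quadratic form in truncated integrals -/

section Kernel

variable {ι : Type} [DecidableEq ι] {d : ℕ}

lemma continuous_monY (k : ι × MonIdx d) (i : ι) :
    Continuous fun p : ℝ × ℝ => monY ι d p.1 p.2 k i := by
  simp only [monY, of_apply]
  split_ifs <;> fun_prop

variable [Fintype ι]

lemma monY_mulVec_apply (z x : ℝ) (u : ι → ℝ) (k : ι × MonIdx d) :
    (monY ι d z x *ᵥ u) k = z ^ k.2.val.1.val * x ^ k.2.val.2.val * u k.1 := by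
  simp [monY, mulVec, dotProduct]

/-- `Y(z, x) f(x)`, cut off outside `(z, x) ∈ s`. -/
def cut (d : ℕ) (s : Set (ℝ × ℝ)) (f : ℝ → ι → ℝ) (z x : ℝ) : ι × MonIdx d → ℝ :=
  s.indicator (fun p => monY ι d p.1 p.2 *ᵥ f p.2) (z, x)

/-- `z ↦ ∫ Y(z, x) f(x) dx`, the integral being over the section `{x | (z, x) ∈ s}`. -/
def cutIntegral (d : ℕ) (s : Set (ℝ × ℝ)) (f : ℝ → ι → ℝ) (z : ℝ) : ι × MonIdx d → ℝ :=
  fun k => ∫ x, cut d s f z x k ∂μI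

lemma cut_apply (s : Set (ℝ × ℝ)) (f : ℝ → ι → ℝ) (z x : ℝ) (k : ι × MonIdx d) :
    cut d s f z x k
      = s.indicator (fun p => p.1 ^ k.2.val.1.val * p.2 ^ k.2.val.2.val * f p.2 k.1) (z, x) := by
  unfold cut
  by_cases h : (z, x) ∈ s <;> simp [h, monY_mulVec_apply]

lemma integrable_cut {s : Set (ℝ × ℝ)} (hs : MeasurableSet s) {f : ℝ → ι → ℝ}
    (hf : MemLp f 2 μI) (z : ℝ) (k : ι × MonIdx d) :
    Integrable (fun x => cut d s f z x k) μI := by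
  obtain ⟨c, hc⟩ := exists_ae_bound
    (k := fun x => z ^ k.2.val.1.val * x ^ k.2.val.2.val) (by fun_prop)
  have h1 : Integrable (fun x => z ^ k.2.val.1.val * x ^ k.2.val.2.val * f x k.1) μI :=
    ((hf.eval k.1).integrable (by norm_num)).bdd_mul
      (Continuous.aestronglyMeasurable (by fun_prop)) hc
  refine (h1.indicator (measurable_prodMk_left hs : MeasurableSet (Prod.mk z ⁻¹' s))).congr
    (.of_forall fun x => ?_)
  simp only [cut_apply]
  rfl

lemma integrable_prod_cut {s : Set (ℝ × ℝ)} (hs : MeasurableSet s) {f : ℝ → ι → ℝ}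
    (hf : MemLp f 2 μI) (k : ι × MonIdx d) :
    Integrable (fun p : ℝ × ℝ => cut d s f p.1 p.2 k) (μI.prod μI) := by
  have h1 := integrable_prod_mul_mul (integrable_const (1 : ℝ))
    ((hf.eval k.1).integrable (by norm_num))
    (k := fun z x => z ^ k.2.val.1.val * x ^ k.2.val.2.val) (by fun_prop)
  refine (h1.indicator hs).congr (.of_forall fun p => ?_)
  simp only [cut_apply, indicator, one_mul]

lemma abs_cut_le {s : Set (ℝ × ℝ)} (f : ℝ → ι → ℝ) {z x : ℝ} (hz : z ∈ Icc (0 : ℝ) 1)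
    (hx : x ∈ Icc (0 : ℝ) 1) (k : ι × MonIdx d) : |cut d s f z x k| ≤ |f x k.1| := by
  rw [cut_apply]
  refine (norm_indicator_le_norm_self (E := ℝ) _ _).trans ?_
  simp only [Real.norm_eq_abs, abs_mul, abs_pow, abs_of_nonneg hz.1, abs_of_nonneg hx.1]
  exact mul_le_of_le_one_left (abs_nonneg _)
    (mul_le_one₀ (pow_le_one₀ hz.1 hz.2) (pow_nonneg hx.1 _) (pow_le_one₀ hx.1 hx.2))

lemma memLp_cutIntegral {s : Set (ℝ × ℝ)} (hs : MeasurableSet s) {f : ℝ → ι → ℝ}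
    (hf : MemLp f 2 μI) : MemLp (cutIntegral d s f) 2 μI := by
  refine memLp_pi_iff.2 fun k => ?_
  refine MemLp.of_bound (integrable_prod_cut hs hf k).integral_prod_left.aestronglyMeasurable
    (∫ x, |f x k.1| ∂μI) ?_
  filter_upwards [ae_mem_Icc] with z hz
  refine norm_integral_le_of_norm_le ((hf.eval k.1).integrable (by norm_num)).abs ?_
  filter_upwards [ae_mem_Icc] with x hx using abs_cut_le f hz hx k

lemma dotProduct_mulVec_integral {m n : Type} [Fintype m] [Fintype n] (u : m → ℝ)
    (M : Matrix m n ℝ) {φ : ℝ → n → ℝ} (hφ : ∀ k, Integrable (fun y => φ y k) μI) :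
    u ⬝ᵥ M *ᵥ (fun k => ∫ y, φ y k ∂μI) = ∫ y, u ⬝ᵥ M *ᵥ φ y ∂μI := by
  simp_rw [dotProduct_mulVec_eq_sum]
  symm
  refine (integral_finsetSum _ fun i _ => integrable_finsetSum _ fun j _ =>
    ((hφ j).const_mul (M i j)).const_mul (u i)).trans (Finset.sum_congr rfl fun i _ => ?_)
  refine (integral_finsetSum _ fun j _ => ((hφ j).const_mul (M i j)).const_mul (u i)).trans
    (Finset.sum_congr rfl fun j _ => ?_)
  rw [integral_const_mul, integral_const_mul]

/-- Fubini: the inner integral in `cutIntegral` is pulled out, and the cut-off becomes the domain of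
integration. This is the source of the `P12` and `P13` terms of the kernel. -/
lemma integral_dotProduct_cutIntegral {s : Set (ℝ × ℝ)} (hs : MeasurableSet s) {f : ℝ → ι → ℝ}
    (hf : MemLp f 2 μI) (P : Matrix ι (ι × MonIdx d) ℝ[X]) :
    ∫ x, f x ⬝ᵥ evalMat P x *ᵥ cutIntegral d s f x ∂μI
      = ∫ p in s, f p.1 ⬝ᵥ (evalMat P p.1 * monY ι d p.1 p.2) *ᵥ f p.2 ∂(μI.prod μI) := by
  have hint := integrable_prod_dotProduct_mulVec hf hf
    (K := fun x y => evalMat P x * monY ι d x y) fun i j => by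
      simp only [Matrix.mul_apply]
      exact continuous_finsetSum _ fun k _ =>
        ((continuous_evalMat P i k).comp continuous_fst).mul (continuous_monY k j)
  rw [← integral_indicator hs, integral_prod _ (hint.indicator hs)]
  refine integral_congr_ae (.of_forall fun x => ?_)
  refine (dotProduct_mulVec_integral _ _ fun k => integrable_cut hs hf x k).trans ?_
  refine integral_congr_ae (.of_forall fun y => ?_)
  by_cases h : (x, y) ∈ s <;> simp [h, cut, mulVec_mulVec]

/-- The Fubini hypothesis for the terms quadratic in the truncated integrals: products of
coordinates of `f` are integrable, and the monomials are at most one on the unit cube. -/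
lemma integrable_triple {f : ℝ → ι → ℝ} (hf : MemLp f 2 μI)
    (P : Matrix (ι × MonIdx d) (ι × MonIdx d) ℝ) {s t : Set (ℝ × ℝ)} (hs : MeasurableSet s)
    (ht : MeasurableSet t) :
    Integrable (fun q : ℝ × (ℝ × ℝ) => cut d s f q.1 q.2.1 ⬝ᵥ P *ᵥ cut d t f q.1 q.2.2)
      (μI.prod (μI.prod μI)) := by
  simp_rw [dotProduct_mulVec_eq_sum]
  refine integrable_finsetSum _ fun k _ => integrable_finsetSum _ fun l _ => ?_
  have h1 : Integrable (fun q : ℝ × (ℝ × ℝ) => (P k l : ℝ) * (f q.2.1 k.1 * f q.2.2 l.1))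
      (μI.prod (μI.prod μI)) :=
    (integrable_const (P k l)).mul_prod
      (((hf.eval k.1).integrable (by norm_num)).mul_prod ((hf.eval l.1).integrable (by norm_num)))
  have h2 : Integrable (fun q : ℝ × (ℝ × ℝ) =>
      (q.1 ^ k.2.val.1.val * q.2.1 ^ k.2.val.2.val * (q.1 ^ l.2.val.1.val * q.2.2 ^ l.2.val.2.val))
        * ((P k l : ℝ) * (f q.2.1 k.1 * f q.2.2 l.1))) (μI.prod (μI.prod μI)) := by
    refine h1.bdd_mul (c := 1) (Continuous.aestronglyMeasurable (by fun_prop)) ?_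
    rw [Measure.prod_restrict, Measure.prod_restrict]
    filter_upwards [ae_restrict_mem
      (measurableSet_Icc.prod (measurableSet_Icc.prod measurableSet_Icc))] with q ⟨hz, hx, hy⟩
    have key : ∀ (a b : ℕ) (z x : ℝ), z ∈ Icc (0 : ℝ) 1 → x ∈ Icc (0 : ℝ) 1 →
        0 ≤ z ^ a * x ^ b ∧ z ^ a * x ^ b ≤ 1 := fun a b z x hz hx =>
      ⟨mul_nonneg (pow_nonneg hz.1 _) (pow_nonneg hx.1 _),
        mul_le_one₀ (pow_le_one₀ hz.1 hz.2) (pow_nonneg hx.1 _) (pow_le_one₀ hx.1 hx.2)⟩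
    obtain ⟨h3, h4⟩ := key k.2.val.1.val k.2.val.2.val _ _ hz hx
    obtain ⟨h5, h6⟩ := key l.2.val.1.val l.2.val.2.val _ _ hz hy
    rw [Real.norm_eq_abs, abs_of_nonneg (mul_nonneg h3 h5)]
    exact mul_le_one₀ h4 h5 h6
  have hS : MeasurableSet {q : ℝ × (ℝ × ℝ) | (q.1, q.2.1) ∈ s ∧ (q.1, q.2.2) ∈ t} :=
    (hs.preimage (by fun_prop)).inter (ht.preimage (by fun_prop))
  refine (h2.indicator hS).congr (.of_forall fun q => ?_)
  simp only [cut_apply]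
  by_cases h3 : (q.1, q.2.1) ∈ s <;> by_cases h4 : (q.1, q.2.2) ∈ t <;> simp [h3, h4]
  ring

/-- The product of two single integrals is a double integral over `(x, y)`. Swapping it with the `z`
integral leaves an inner integral that depends on `f` only through `f x` and `f y`, that is, a
kernel. -/
lemma integral_cutIntegral_dotProduct {f : ℝ → ι → ℝ} (hf : MemLp f 2 μI)
    (P : Matrix (ι × MonIdx d) (ι × MonIdx d) ℝ) {s t : Set (ℝ × ℝ)} (hs : MeasurableSet s)
    (ht : MeasurableSet t) :
    ∫ z, cutIntegral d s f z ⬝ᵥ P *ᵥ cutIntegral d t f z ∂μI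
      = ∫ p, (∫ z, cut d s f z p.1 ⬝ᵥ P *ᵥ cut d t f z p.2 ∂μI) ∂(μI.prod μI) := by
  rw [← integral_integral_swap (integrable_triple hf P hs ht)]
  refine integral_congr_ae (.of_forall fun z => ?_)
  have hint : ∀ k l, Integrable
      (fun p : ℝ × ℝ => cut d s f z p.1 k * (P k l * cut d t f z p.2 l)) (μI.prod μI) :=
    fun k l => (integrable_cut hs hf z k).mul_prod ((integrable_cut ht hf z l).const_mul _)
  simp_rw [dotProduct_mulVec_eq_sum]
  symm
  refine (integral_finsetSum _ fun k _ => integrable_finsetSum _ fun l _ => hint k l).trans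
    (Finset.sum_congr rfl fun k _ => ?_)
  refine (integral_finsetSum _ fun l _ => hint k l).trans (Finset.sum_congr rfl fun l _ => ?_)
  rw [integral_prod_mul (fun x => cut d s f z x k) (fun y => P k l * cut d t f z y l),
    integral_const_mul]
  rfl

lemma ae_fst_ne_snd : ∀ᵐ p ∂(μI.prod μI), p.1 ≠ p.2 := by
  have hm : MeasurableSet {p : ℝ × ℝ | p.1 = p.2} :=
    measurableSet_eq_fun measurable_fst measurable_snd
  rw [ae_iff]
  simp only [ne_eq, not_not]
  rw [Measure.measure_prod_null hm]
  refine .of_forall fun x => ?_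
  have : Prod.mk x ⁻¹' {p : ℝ × ℝ | p.1 = p.2} = {x} := by ext y; simp [eq_comm]
  simp [this]

lemma integral_upper_eq {Φ : ℝ × ℝ → ℝ} :
    ∫ p in {p | p.1 ≤ p.2}, Φ p ∂(μI.prod μI) = ∫ p, Φ p.swap ∂μTri := by
  have hm : MeasurableSet {p : ℝ × ℝ | p.1 ≤ p.2} :=
    measurableSet_le measurable_fst measurable_snd
  rw [← integral_indicator hm, ← integral_indicator measurableSet_tri, ← integral_prod_swap]
  rfl

/-- An integral over the unit square, folded along the diagonal. -/
lemma integral_prod_eq_integral_tri {Φ : ℝ × ℝ → ℝ} (hΦ : Integrable Φ (μI.prod μI)) :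
    ∫ p, Φ p ∂(μI.prod μI) = ∫ p, (Φ p + Φ p.swap) ∂μTri := by
  have hs : Integrable (fun p : ℝ × ℝ => Φ p.swap) (μI.prod μI) := hΦ.swap
  rw [integral_add hΦ.restrict hs.restrict, ← integral_upper_eq,
    ← integral_add_compl measurableSet_tri hΦ]
  congr 1
  -- The complement of the closed lower triangle is the open upper one; it differs from the closed
  -- one by the null diagonal.
  refine setIntegral_congr_set ?_
  filter_upwards [ae_fst_ne_snd] with p hp
  simp only [eq_iff_iff]
  change p ∈ {p : ℝ × ℝ | p.2 ≤ p.1}ᶜ ↔ p ∈ {p : ℝ × ℝ | p.1 ≤ p.2}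
  simp only [mem_compl_iff, mem_ofPred_eq, not_le]
  exact ⟨le_of_lt, fun h => lt_of_le_of_ne h hp⟩



lemma integral_indicator_Icc {a b : ℝ} (ha : 0 ≤ a) (hab : a ≤ b) (hb : b ≤ 1) (φ : ℝ → ℝ) :
    ∫ z, (Icc a b).indicator φ z ∂μI = ∫ z in a..b, φ z := by
  rw [integral_indicator measurableSet_Icc, Measure.restrict_restrict measurableSet_Icc,
    inter_eq_left.2 (Icc_subset_Icc ha hb), integral_Icc_eq_integral_Ioc,
    intervalIntegral.integral_of_le hab]

lemma dotProduct_matIntegral_mulVec {m n : Type} [Fintype m] [Fintype n]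
    {M : ℝ → Matrix m n ℝ} (hM : ∀ i j, Continuous fun z => M z i j) (a b : ℝ) (u : m → ℝ)
    (v : n → ℝ) :
    u ⬝ᵥ matIntegral M a b *ᵥ v = ∫ z in a..b, u ⬝ᵥ M z *ᵥ v := by
  have hint : ∀ i j, IntervalIntegrable (fun z => u i * (M z i j * v j)) volume a b := fun i j =>
    (((hM i j).mul continuous_const).const_mul _).intervalIntegrable _ _
  simp_rw [dotProduct_mulVec_eq_sum]
  symm
  refine (intervalIntegral.integral_finsetSum fun i _ => ?_).trans
    (Finset.sum_congr rfl fun i _ => ?_)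
  · exact (Continuous.intervalIntegrable (continuous_finsetSum _ fun j _ =>
      ((hM i j).mul continuous_const).const_mul _) _ _)
  refine (intervalIntegral.integral_finsetSum fun j _ => hint i j).trans
    (Finset.sum_congr rfl fun j _ => ?_)
  rw [intervalIntegral.integral_const_mul, intervalIntegral.integral_mul_const]
  rfl

lemma continuous_monY_transpose_mul_mul (P : Matrix (ι × MonIdx d) (ι × MonIdx d) ℝ)
    {X : Type} [TopologicalSpace X] {a b c : X → ℝ} (ha : Continuous a) (hb : Continuous b)
    (hc : Continuous c) (i j : ι) :
    Continuous fun q : X => ((monY ι d (a q) (b q))ᵀ * P * monY ι d (a q) (c q)) i j := by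
  simp only [Matrix.mul_apply, transpose_apply]
  refine continuous_finsetSum _ fun k _ => Continuous.mul
    (continuous_finsetSum _ fun l _ => Continuous.mul ?_ continuous_const) ?_
  · exact (continuous_monY l i).comp (ha.prodMk hb)
  · exact (continuous_monY k j).comp (ha.prodMk hc)

/-- Both limits move, so the integral is split as `∫₀^b - ∫₀^a`, each with a single moving limit. -/
lemma continuous_matIntegral (P : Matrix (ι × MonIdx d) (ι × MonIdx d) ℝ) {a b : ℝ × ℝ → ℝ}
    (ha : Continuous a) (hb : Continuous b) (i j : ι) :
    Continuous fun p : ℝ × ℝ =>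
      matIntegral (fun z => (monY ι d z p.1)ᵀ * P * monY ι d z p.2) (a p) (b p) i j := by
  set φ : ℝ × ℝ → ℝ → ℝ := fun p z => ((monY ι d z p.1)ᵀ * P * monY ι d z p.2) i j with hφ
  have hc : Continuous (Function.uncurry φ) :=
    continuous_monY_transpose_mul_mul P (X := (ℝ × ℝ) × ℝ) continuous_snd
      (continuous_fst.comp continuous_fst) (continuous_snd.comp continuous_fst) i j
  have hi : ∀ (p : ℝ × ℝ) (a b : ℝ), IntervalIntegrable (φ p) volume a b := fun p a b =>
    (hc.comp (Continuous.prodMk_right p)).intervalIntegrable _ _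
  have h1 := intervalIntegral.continuous_parametric_intervalIntegral_of_continuous
    (a₀ := 0) (μ := volume) hc ha
  have h2 := intervalIntegral.continuous_parametric_intervalIntegral_of_continuous
    (a₀ := 0) (μ := volume) hc hb
  refine (h2.sub h1).congr fun p => ?_
  exact intervalIntegral.integral_interval_sub_left (hi p _ _) (hi p _ _)

/-- For fixed `x, y` the two cut-offs are simultaneously active exactly for `z ∈ [a, b]`; this
interval provides the limits of integration in the kernel. -/
lemma integral_cut_dotProduct {f : ℝ → ι → ℝ} (P : Matrix (ι × MonIdx d) (ι × MonIdx d) ℝ)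
    {s t : Set (ℝ × ℝ)} {a b x y : ℝ} (ha : 0 ≤ a) (hab : a ≤ b) (hb : b ≤ 1)
    (h : ∀ z ∈ Icc (0 : ℝ) 1, ((z, x) ∈ s ∧ (z, y) ∈ t ↔ z ∈ Icc a b)) :
    ∫ z, cut d s f z x ⬝ᵥ P *ᵥ cut d t f z y ∂μI
      = f x ⬝ᵥ matIntegral (fun z => (monY ι d z x)ᵀ * P * monY ι d z y) a b *ᵥ f y := by
  have hc : ∀ i j, Continuous fun z => ((monY ι d z x)ᵀ * P * monY ι d z y) i j := fun i j =>
    continuous_monY_transpose_mul_mul P continuous_id continuous_const continuous_const i j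
  rw [dotProduct_matIntegral_mulVec hc, ← integral_indicator_Icc ha hab hb]
  refine integral_congr_ae ?_
  filter_upwards [ae_mem_Icc] with z hz
  have h1 := h z hz
  have h2 : (monY ι d z x *ᵥ f x) ⬝ᵥ P *ᵥ (monY ι d z y *ᵥ f y)
      = f x ⬝ᵥ ((monY ι d z x)ᵀ * P * monY ι d z y) *ᵥ f y := by
    rw [Matrix.mul_assoc, ← mulVec_mulVec, ← mulVec_mulVec, dotProduct_transpose_mulVec,
      dotProduct_comm]
  by_cases h3 : z ∈ Icc a b
  · simp only [cut, (h1.2 h3).1, (h1.2 h3).2, h3, indicator_of_mem, h2]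
  · rw [indicator_of_notMem h3]
    rcases not_and_or.1 (mt h1.1 h3) with h4 | h4 <;> simp [cut, h4]

/-- A scalar equals its transpose. This brings the half of a folded integral that has `x` and `y`
exchanged back to the orientation `f(x)ᵀ … f(y)`. -/
lemma dotProduct_matIntegral_swap (P : Matrix (ι × MonIdx d) (ι × MonIdx d) ℝ) (a b x y : ℝ)
    (u v : ι → ℝ) :
    v ⬝ᵥ matIntegral (fun z => (monY ι d z y)ᵀ * P * monY ι d z x) a b *ᵥ u
      = u ⬝ᵥ matIntegral (fun z => (monY ι d z x)ᵀ * Pᵀ * monY ι d z y) a b *ᵥ v := by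
  rw [← dotProduct_transpose_mulVec]
  congr 2
  ext i j
  simp only [matIntegral, of_apply, transpose_apply]
  refine intervalIntegral.integral_congr fun z _ => ?_
  have : ((monY ι d z x)ᵀ * Pᵀ * monY ι d z y) = ((monY ι d z y)ᵀ * P * monY ι d z x)ᵀ := by
    simp [transpose_mul, Matrix.mul_assoc]
  simp only [this, transpose_apply]

lemma ae_tri : ∀ᵐ p ∂μTri, 0 ≤ p.2 ∧ p.2 < p.1 ∧ p.1 ≤ 1 := by
  filter_upwards [ae_restrict_of_ae ae_prod_mem_Icc, ae_restrict_of_ae ae_fst_ne_snd,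
    ae_restrict_mem measurableSet_tri] with p h1 h2 h3
  exact ⟨h1.2.1, lt_of_le_of_ne h3 (Ne.symm h2), h1.1.2⟩

/-- `z ↦ ∫₀^z Y(z, x) f(x) dx`. -/
def lowerIntegral (d : ℕ) (f : ℝ → ι → ℝ) : ℝ → ι × MonIdx d → ℝ :=
  cutIntegral d {p | p.2 ≤ p.1} f

/-- `z ↦ ∫_z^1 Y(z, x) f(x) dx`. -/
def upperIntegral (d : ℕ) (f : ℝ → ι → ℝ) : ℝ → ι × MonIdx d → ℝ :=
  cutIntegral d {p | p.1 ≤ p.2} f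

lemma measurableSet_upper : MeasurableSet {p : ℝ × ℝ | p.1 ≤ p.2} :=
  measurableSet_le measurable_fst measurable_snd

lemma memLp_lowerIntegral {f : ℝ → ι → ℝ} (hf : MemLp f 2 μI) :
    MemLp (lowerIntegral d f) 2 μI :=
  memLp_cutIntegral measurableSet_tri hf

lemma memLp_upperIntegral {f : ℝ → ι → ℝ} (hf : MemLp f 2 μI) :
    MemLp (upperIntegral d f) 2 μI :=
  memLp_cutIntegral measurableSet_upper hf

/-- Both cut-offs hold for `z ≥ max x y`, which is `x` on the triangle. The two folded halves agree
by symmetry of `P`, whence the factor 2. -/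
lemma integral_lower_lower {f : ℝ → ι → ℝ} (hf : MemLp f 2 μI)
    {P : Matrix (ι × MonIdx d) (ι × MonIdx d) ℝ} (hP : P.IsSymm) :
    ∫ z, lowerIntegral d f z ⬝ᵥ P *ᵥ lowerIntegral d f z ∂μI
      = 2 * ∫ p, f p.1 ⬝ᵥ matIntegral (fun z => (monY ι d z p.1)ᵀ * P * monY ι d z p.2) p.1 1
          *ᵥ f p.2 ∂μTri := by
  rw [lowerIntegral, integral_cutIntegral_dotProduct hf P measurableSet_tri measurableSet_tri,
    integral_prod_eq_integral_tri
      (integrable_triple hf P measurableSet_tri measurableSet_tri).integral_prod_right,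
    ← integral_const_mul]
  refine integral_congr_ae ?_
  filter_upwards [ae_tri] with p ⟨h0, h1, h2⟩
  have h3 := h0.trans h1.le
  simp only [Prod.fst_swap, Prod.snd_swap]
  rw [integral_cut_dotProduct P (a := p.1) (b := 1) h3 h2 le_rfl,
    integral_cut_dotProduct P (a := p.1) (b := 1) h3 h2 le_rfl, dotProduct_matIntegral_swap, hP.eq]
  · ring
  all_goals
    intro z hz
    simp only [mem_ofPred_eq, mem_Icc]
    constructor
    · rintro ⟨h4, h5⟩
      exact ⟨by assumption, hz.2⟩
    · rintro ⟨h4, h5⟩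
      constructor <;> linarith

/-- Here the cut-offs hold for `z ≤ min x y`, which is `y` on the triangle. -/
lemma integral_upper_upper {f : ℝ → ι → ℝ} (hf : MemLp f 2 μI)
    {P : Matrix (ι × MonIdx d) (ι × MonIdx d) ℝ} (hP : P.IsSymm) :
    ∫ z, upperIntegral d f z ⬝ᵥ P *ᵥ upperIntegral d f z ∂μI
      = 2 * ∫ p, f p.1 ⬝ᵥ matIntegral (fun z => (monY ι d z p.1)ᵀ * P * monY ι d z p.2) 0 p.2
          *ᵥ f p.2 ∂μTri := by
  rw [upperIntegral, integral_cutIntegral_dotProduct hf P measurableSet_upper measurableSet_upper,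
    integral_prod_eq_integral_tri
      (integrable_triple hf P measurableSet_upper measurableSet_upper).integral_prod_right,
    ← integral_const_mul]
  refine integral_congr_ae ?_
  filter_upwards [ae_tri] with p ⟨h0, h1, h2⟩
  have h3 := h1.le.trans h2
  simp only [Prod.fst_swap, Prod.snd_swap]
  rw [integral_cut_dotProduct P (a := 0) (b := p.2) le_rfl h0 h3,
    integral_cut_dotProduct P (a := 0) (b := p.2) le_rfl h0 h3, dotProduct_matIntegral_swap, hP.eq]
  · ring
  all_goals
    intro z hz
    simp only [mem_ofPred_eq, mem_Icc]
    constructor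
    · rintro ⟨h4, h5⟩
      exact ⟨hz.1, by assumption⟩
    · rintro ⟨h4, h5⟩
      constructor <;> linarith

/-- The lower variable must lie below `z` and the upper one above it. Only one of the two folded
halves allows this, so there is no factor 2, and since it is the exchanged half, `Pᵀ` appears. -/
lemma integral_lower_upper {f : ℝ → ι → ℝ} (hf : MemLp f 2 μI)
    (P : Matrix (ι × MonIdx d) (ι × MonIdx d) ℝ) :
    ∫ z, lowerIntegral d f z ⬝ᵥ P *ᵥ upperIntegral d f z ∂μI
      = ∫ p, f p.1 ⬝ᵥ matIntegral (fun z => (monY ι d z p.1)ᵀ * Pᵀ * monY ι d z p.2) p.2 p.1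
          *ᵥ f p.2 ∂μTri := by
  rw [lowerIntegral, upperIntegral,
    integral_cutIntegral_dotProduct hf P measurableSet_tri measurableSet_upper,
    integral_prod_eq_integral_tri
      (integrable_triple hf P measurableSet_tri measurableSet_upper).integral_prod_right]
  refine integral_congr_ae ?_
  filter_upwards [ae_tri] with p ⟨h0, h1, h2⟩
  simp only [Prod.fst_swap, Prod.snd_swap]
  rw [integral_cut_dotProduct P (x := p.2) (y := p.1) (a := p.2) (b := p.1) h0 h1.le h2 fun z _ =>
    Iff.rfl, dotProduct_matIntegral_swap, add_eq_right]
  refine integral_eq_zero_of_ae (.of_forall fun z => ?_)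
  by_cases h : p.1 ≤ z
  · simp [cut, not_le.2 (h1.trans_le h)]
  · simp [cut, h]

lemma integral_dotProduct_lower {f : ℝ → ι → ℝ} (hf : MemLp f 2 μI)
    (P : Matrix ι (ι × MonIdx d) ℝ[X]) :
    ∫ x, f x ⬝ᵥ evalMat P x *ᵥ lowerIntegral d f x ∂μI
      = ∫ p, f p.1 ⬝ᵥ (evalMat P p.1 * monY ι d p.1 p.2) *ᵥ f p.2 ∂μTri :=
  integral_dotProduct_cutIntegral measurableSet_tri hf P

/-- The natural domain is the upper triangle; reflecting it onto the lower one transposes the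
kernel. -/
lemma integral_dotProduct_upper {f : ℝ → ι → ℝ} (hf : MemLp f 2 μI)
    (P : Matrix ι (ι × MonIdx d) ℝ[X]) :
    ∫ x, f x ⬝ᵥ evalMat P x *ᵥ upperIntegral d f x ∂μI
      = ∫ p, f p.1 ⬝ᵥ ((monY ι d p.2 p.1)ᵀ * (evalMat P p.2)ᵀ) *ᵥ f p.2 ∂μTri := by
  refine (integral_dotProduct_cutIntegral measurableSet_upper hf P).trans ?_
  rw [integral_upper_eq]
  refine integral_congr_ae (.of_forall fun p => ?_)
  simp only [Prod.fst_swap, Prod.snd_swap]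
  rw [← transpose_mul, dotProduct_transpose_mulVec]

/-! ### Continuity of the kernel, and its quadratic form -/

section Continuity

variable (P12 P13 : Matrix ι (ι × MonIdx d) ℝ[X])
  (P22 P23 P33 : Matrix (ι × MonIdx d) (ι × MonIdx d) ℝ)

lemma continuous_evalMat_mul_monY (i j : ι) :
    Continuous fun p : ℝ × ℝ => (evalMat P12 p.1 * monY ι d p.1 p.2) i j := by
  simp only [Matrix.mul_apply]
  exact continuous_finsetSum _ fun k _ =>
    ((continuous_evalMat P12 i k).comp continuous_fst).mul (continuous_monY k j)

lemma continuous_monY_transpose_mul (i j : ι) :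
    Continuous fun p : ℝ × ℝ => ((monY ι d p.2 p.1)ᵀ * (evalMat P13 p.2)ᵀ) i j := by
  simp only [← transpose_mul, transpose_apply]
  exact (continuous_evalMat_mul_monY P13 j i).comp continuous_swap

lemma continuous_kernel (i j : ι) :
    Continuous fun p : ℝ × ℝ => kernel P12 P13 P22 P23 P33 p.1 p.2 i j := by
  simp only [kernel, Matrix.add_apply]
  exact ((((continuous_evalMat_mul_monY P12 i j).add (continuous_monY_transpose_mul P13 i j)).add
    (continuous_matIntegral P33 continuous_const continuous_snd i j)).add
    (continuous_matIntegral P23ᵀ continuous_snd continuous_fst i j)).add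
    (continuous_matIntegral P22 continuous_fst continuous_const i j)

/-- The five summands of `kernel` are, in some order, the five products of `f` and its truncated
integrals, each folded onto the triangle. -/
lemma integral_kernel_eq {f : ℝ → ι → ℝ} (hf : MemLp f 2 μI) (hP22 : P22.IsSymm)
    (hP33 : P33.IsSymm) :
    2 * ∫ p, f p.1 ⬝ᵥ kernel P12 P13 P22 P23 P33 p.1 p.2 *ᵥ f p.2 ∂μTri
      = 2 * ∫ x, f x ⬝ᵥ evalMat P12 x *ᵥ lowerIntegral d f x ∂μI
        + 2 * ∫ x, f x ⬝ᵥ evalMat P13 x *ᵥ upperIntegral d f x ∂μI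
        + ∫ x, lowerIntegral d f x ⬝ᵥ P22 *ᵥ lowerIntegral d f x ∂μI
        + 2 * ∫ x, lowerIntegral d f x ⬝ᵥ P23 *ᵥ upperIntegral d f x ∂μI
        + ∫ x, upperIntegral d f x ⬝ᵥ P33 *ᵥ upperIntegral d f x ∂μI := by
  rw [integral_lower_lower hf hP22, integral_upper_upper hf hP33, integral_lower_upper hf,
    integral_dotProduct_lower hf, integral_dotProduct_upper hf]
  have i1 := integrable_tri_dotProduct_mulVec hf hf
    (K := fun x y => evalMat P12 x * monY ι d x y) (continuous_evalMat_mul_monY P12)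
  have i2 := integrable_tri_dotProduct_mulVec hf hf
    (K := fun x y => (monY ι d y x)ᵀ * (evalMat P13 y)ᵀ) (continuous_monY_transpose_mul P13)
  have i3 := integrable_tri_dotProduct_mulVec hf hf
    (K := fun x y => matIntegral (fun z => (monY ι d z x)ᵀ * P33 * monY ι d z y) 0 y)
    (continuous_matIntegral P33 continuous_const continuous_snd)
  have i4 := integrable_tri_dotProduct_mulVec hf hf
    (K := fun x y => matIntegral (fun z => (monY ι d z x)ᵀ * P23ᵀ * monY ι d z y) y x)
    (continuous_matIntegral P23ᵀ continuous_snd continuous_fst)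
  have i5 := integrable_tri_dotProduct_mulVec hf hf
    (K := fun x y => matIntegral (fun z => (monY ι d z x)ᵀ * P22 * monY ι d z y) x 1)
    (continuous_matIntegral P22 continuous_fst continuous_const)
  simp only [kernel, add_mulVec, dotProduct_add]
  rw [integral_add (((i1.fun_add i2).fun_add i3).fun_add i4) i5,
    integral_add ((i1.fun_add i2).fun_add i3) i4, integral_add (i1.fun_add i2) i3, integral_add i1 i2]
  ring

/-- The quadratic form of the block matrix, on the truncated integrals of `f`, in terms of the
kernel. -/
lemma integral_blockMat_eq {ν : Type} [Fintype ν] (Pb : Matrix ν ν ℝ[X])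
    (Q12 Q13 : Matrix ν (ι × MonIdx d) ℝ[X]) {f : ℝ → ι → ℝ} (hf : MemLp f 2 μI)
    {u : ℝ → ν → ℝ} (hu : MemLp u 2 μI) (hP22 : P22.IsSymm) (hP33 : P33.IsSymm)
    (h12 : ∀ x v, u x ⬝ᵥ evalMat Q12 x *ᵥ v = f x ⬝ᵥ evalMat P12 x *ᵥ v)
    (h13 : ∀ x v, u x ⬝ᵥ evalMat Q13 x *ᵥ v = f x ⬝ᵥ evalMat P13 x *ᵥ v) :
    ∫ x, Sum.elim (u x) (Sum.elim (lowerIntegral d f x) (upperIntegral d f x))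
        ⬝ᵥ evalMat (blockMat Pb Q12 Q13 P22 P23 P33) x
        *ᵥ Sum.elim (u x) (Sum.elim (lowerIntegral d f x) (upperIntegral d f x)) ∂μI
      = ∫ x, u x ⬝ᵥ evalMat Pb x *ᵥ u x ∂μI
        + 2 * ∫ p, f p.1 ⬝ᵥ kernel P12 P13 P22 P23 P33 p.1 p.2 *ᵥ f p.2 ∂μTri := by
  simp_rw [dotProduct_evalMat_blockMat, h12, h13]
  have hl := memLp_lowerIntegral (d := d) hf
  have hr := memLp_upperIntegral (d := d) hf
  have i0 := integrable_dotProduct_mulVec hu hu (continuous_evalMat Pb)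
  have i1 := (integrable_dotProduct_mulVec hf hl (continuous_evalMat P12)).const_mul 2
  have i2 := (integrable_dotProduct_mulVec hf hr (continuous_evalMat P13)).const_mul 2
  have i3 := integrable_dotProduct_mulVec hl hl (M := fun _ => P22) fun _ _ => continuous_const
  have i4 := (integrable_dotProduct_mulVec hl hr (M := fun _ => P23)
    fun _ _ => continuous_const).const_mul 2
  have i5 := integrable_dotProduct_mulVec hr hr (M := fun _ => P33) fun _ _ => continuous_const
  rw [integral_kernel_eq P12 P13 P22 P23 P33 hf hP22 hP33,
    integral_add ((((i0.fun_add i1).fun_add i2).fun_add i3).fun_add i4) i5,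
    integral_add (((i0.fun_add i1).fun_add i2).fun_add i3) i4, integral_add ((i0.fun_add i1).fun_add i2) i3,
    integral_add (i0.fun_add i1) i2, integral_add i0 i1]
  simp only [integral_const_mul]
  ring

end Continuity

end Kernel

/-! ### Absolutely continuous functions on the unit interval -/

/-- `g` is absolutely continuous on `[0,1]` with almost everywhere derivative `g'`. -/
structure HasACDeriv (g g' : ℝ → ℝ) : Prop where
  ac : AbsolutelyContinuousOnInterval g 0 1
  ae : ∀ᵐ x ∂μI, HasDerivAt g (g' x) x

namespace HasACDeriv

lemma of_contDiff {g g' : ℝ → ℝ} (hg : ContDiff ℝ 1 g) (h : ∀ x, HasDerivAt g (g' x) x) :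
    HasACDeriv g g' :=
  ⟨hg.contDiffOn.absolutelyContinuousOnInterval, .of_forall h⟩

lemma const (c : ℝ) : HasACDeriv (fun _ => c) fun _ => 0 :=
  of_contDiff contDiff_const fun x => hasDerivAt_const x c

lemma polynomial (p : ℝ[X]) : HasACDeriv (fun x => p.eval x) fun x => p.derivative.eval x :=
  of_contDiff (by simpa using p.contDiff_aeval (R := ℝ) (𝕜 := ℝ) 1) p.hasDerivAt

variable {f f' g g' : ℝ → ℝ}

lemma add (hf : HasACDeriv f f') (hg : HasACDeriv g g') :
    HasACDeriv (fun x => f x + g x) fun x => f' x + g' x :=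
  ⟨hf.ac.add hg.ac, by filter_upwards [hf.ae, hg.ae] with x h1 h2 using h1.add h2⟩

lemma mul (hf : HasACDeriv f f') (hg : HasACDeriv g g') :
    HasACDeriv (fun x => f x * g x) fun x => f' x * g x + f x * g' x :=
  ⟨hf.ac.mul hg.ac, by filter_upwards [hf.ae, hg.ae] with x h1 h2 using h1.mul h2⟩

lemma sum {κ : Type} {s : Finset κ} {f f' : κ → ℝ → ℝ} (h : ∀ i ∈ s, HasACDeriv (f i) (f' i)) :
    HasACDeriv (fun x => ∑ i ∈ s, f i x) fun x => ∑ i ∈ s, f' i x := by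
  classical
  induction s using Finset.induction_on with
  | empty => simpa using const 0
  | insert a s ha ih =>
    simp only [Finset.sum_insert ha]
    exact (h a (Finset.mem_insert_self a s)).add
      (ih fun i hi => h i (Finset.mem_insert_of_mem hi))

/-- The product rule behind every slack identity; constant vectors with derivative zero stand in for
the factors that do not depend on the variable. -/
lemma dotProduct_mulVec {m n : Type} [Fintype m] [Fintype n] {u u' : ℝ → m → ℝ}
    {M M' : ℝ → Matrix m n ℝ} {v v' : ℝ → n → ℝ}
    (hu : ∀ i, HasACDeriv (fun x => u x i) fun x => u' x i)
    (hM : ∀ i j, HasACDeriv (fun x => M x i j) fun x => M' x i j)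
    (hv : ∀ j, HasACDeriv (fun x => v x j) fun x => v' x j) :
    HasACDeriv (fun x => u x ⬝ᵥ M x *ᵥ v x)
      fun x => u' x ⬝ᵥ M x *ᵥ v x + u x ⬝ᵥ M' x *ᵥ v x + u x ⬝ᵥ M x *ᵥ v' x := by
  simp_rw [dotProduct_mulVec_eq_sum, ← Finset.sum_add_distrib]
  refine sum fun i _ => sum fun j _ => ?_
  convert (hu i).mul ((hM i j).mul (hv j)) using 2
  ring

/-- The fundamental theorem of calculus. -/
lemma integral_eq_sub (h : HasACDeriv g g') {a b : ℝ} (ha : 0 ≤ a) (hab : a ≤ b) (hb : b ≤ 1) :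
    ∫ x in a..b, g' x = g b - g a := by
  rw [← (h.ac.mono (c := a) (d := b) (by
    rw [uIcc_of_le hab, uIcc_of_le zero_le_one]
    exact Icc_subset_Icc ha hb)).integral_deriv_eq_sub]
  refine intervalIntegral.integral_congr_ae ?_
  have h1 := (ae_restrict_iff' measurableSet_Icc).1 h.ae
  filter_upwards [h1] with x hx hm
  rw [uIoc_of_le hab] at hm
  exact (hx ⟨ha.trans hm.1.le, hm.2.trans hb⟩).deriv.symm

lemma integral_eq (h : HasACDeriv g g') : ∫ x, g' x ∂μI = g 1 - g 0 := by
  rw [← h.integral_eq_sub le_rfl zero_le_one le_rfl, integral_Icc_eq_integral_Ioc,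
    intervalIntegral.integral_of_le zero_le_one]

lemma integral_indicator_le (h : HasACDeriv g g') {x : ℝ} (hx : x ∈ Icc (0 : ℝ) 1) :
    ∫ y, {y | y ≤ x}.indicator g' y ∂μI = g x - g 0 := by
  rw [← h.integral_eq_sub le_rfl hx.1 hx.2, ← integral_indicator_Icc le_rfl hx.1 hx.2]
  refine integral_congr_ae ?_
  filter_upwards [ae_mem_Icc] with y hy
  by_cases hyx : y ≤ x <;> simp [indicator, hyx, hy.1]

lemma integral_indicator_ge (h : HasACDeriv g g') {x : ℝ} (hx : x ∈ Icc (0 : ℝ) 1) :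
    ∫ y, {y | x ≤ y}.indicator g' y ∂μI = g 1 - g x := by
  rw [← h.integral_eq_sub hx.1 hx.2 le_rfl, ← integral_indicator_Icc hx.1 hx.2 le_rfl]
  refine integral_congr_ae ?_
  filter_upwards [ae_mem_Icc] with y hy
  by_cases hyx : x ≤ y <;> simp [indicator, hyx, hy.2]

lemma memLp (h : HasACDeriv g g') : MemLp g 2 μI := by
  have hc : ContinuousOn g (Icc 0 1) := by simpa [uIcc_of_le] using h.ac.continuousOn
  obtain ⟨c, hc'⟩ := isCompact_Icc.exists_bound_of_continuousOn hc
  exact .of_bound (hc.aestronglyMeasurable measurableSet_Icc) c (ae_mem_Icc.mono hc')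

end HasACDeriv

/-! ### Jets of elements of `ℋ^α` -/

/-- Each coordinate is absolutely continuous, hence differentiable almost everywhere. Off the two
end points `[0,1]` is a neighbourhood, so the one-sided `dx` is the genuine derivative. -/
lemma MemH.hasACDeriv {α β : ℕ} {w : ℝ → EuclideanSpace ℝ (Fin β)} (hw : MemH α w) {i : ℕ}
    (hi : i < α) (b : Fin β) : HasACDeriv (fun x => dx i w x b) fun x => dx (i + 1) w x b := by
  have hac : ∀ b, AbsolutelyContinuousOnInterval (fun x => dx i w x b) 0 1 := by
    intro b
    have h := hw.absolutelyContinuous i hi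
    rw [absolutelyContinuousOnInterval_iff] at h ⊢
    intro ε hε
    obtain ⟨δ, hδ, h⟩ := h ε hε
    refine ⟨δ, hδ, fun E hE hE' => lt_of_le_of_lt (Finset.sum_le_sum fun k _ => ?_) (h E hE hE')⟩
    rw [dist_eq_norm, dist_eq_norm]
    exact PiLp.norm_apply_le (dx i w (E.2 k).1 - dx i w (E.2 k).2) b
  refine ⟨hac b, ?_⟩
  have hd : ∀ᵐ x ∂μI, ∀ b, DifferentiableAt ℝ (fun x => dx i w x b) x := by
    refine ae_all_iff.2 fun b => ?_
    rw [ae_restrict_iff' measurableSet_Icc]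
    simpa [uIcc_of_le] using (hac b).ae_differentiableAt
  have hend : ∀ᵐ x ∂μI, x ≠ 0 ∧ x ≠ 1 := by
    rw [Filter.eventually_and]
    exact ⟨compl_mem_ae_iff.2 (measure_singleton 0), compl_mem_ae_iff.2 (measure_singleton 1)⟩
  filter_upwards [hd, hend, ae_mem_Icc] with x h1 h2 h3
  have hn : Icc (0 : ℝ) 1 ∈ nhds x :=
    Icc_mem_nhds (lt_of_le_of_ne h3.1 (Ne.symm h2.1)) (lt_of_le_of_ne h3.2 h2.2)
  have h4 : DifferentiableAt ℝ (dx i w) x := differentiableAt_euclidean.2 h1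
  have h5 : HasDerivAt (dx i w) (dx (i + 1) w x) x := by
    have h6 : dx (i + 1) w x = derivWithin (dx i w) (Icc 0 1) x := by
      unfold dx
      rw [iteratedDerivWithin_succ]
    rw [h6, derivWithin_of_mem_nhds hn]
    exact h4.hasDerivAt
  exact (EuclideanSpace.proj (𝕜 := ℝ) b).hasFDerivAt.comp_hasDerivAt x h5

lemma MemH.memLp_jet {α β : ℕ} {w : ℝ → EuclideanSpace ℝ (Fin β)} (hw : MemH α w) :
    MemLp (jet (α + 1) w) 2 μI := by
  refine memLp_pi_iff.2 fun p => ?_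
  -- Orders below `α` are continuous, hence bounded; order `α` is square integrable by assumption.
  rcases (Nat.lt_succ_iff.1 p.1.isLt).lt_or_eq with h | h
  · exact (hw.hasACDeriv h p.2).memLp
  · simpa only [jet, h] using hw.memLp.eval_piLp p.2

lemma projN_mulVec_jet {α β : ℕ} (w : ℝ → EuclideanSpace ℝ (Fin β)) (x : ℝ) :
    projN ℝ α β *ᵥ jet (α + 1) w x = jet α w x := by
  ext p
  simp [projN, mulVec, dotProduct, jet]

lemma projNd_mulVec_jet {α β : ℕ} (w : ℝ → EuclideanSpace ℝ (Fin β)) (x : ℝ) (p : JetIdx α β) :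
    (projNd ℝ α β *ᵥ jet (α + 1) w x) p = dx (p.1.val + 1) w x p.2 := by
  simp [projNd, mulVec, dotProduct, jet]

lemma MemH.hasACDeriv_jet {α β : ℕ} {w : ℝ → EuclideanSpace ℝ (Fin β)} (hw : MemH α w)
    (p : JetIdx α β) :
    HasACDeriv (fun x => jet α w x p) fun x => (projNd ℝ α β *ᵥ jet (α + 1) w x) p := by
  simp_rw [projNd_mulVec_jet]
  exact hw.hasACDeriv p.1.isLt p.2

lemma MemH.memLp_jet_lower {α β : ℕ} {w : ℝ → EuclideanSpace ℝ (Fin β)} (hw : MemH α w) :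
    MemLp (jet α w) 2 μI :=
  memLp_pi_iff.2 fun p => (hw.hasACDeriv_jet p).memLp

lemma MemH.memLp_projNd_jet {α β : ℕ} {w : ℝ → EuclideanSpace ℝ (Fin β)} (hw : MemH α w) :
    MemLp (fun x => projNd ℝ α β *ᵥ jet (α + 1) w x) 2 μI := by
  refine memLp_pi_iff.2 fun p => ?_
  simp only [mulVec, dotProduct]
  exact memLp_finsetSum _ fun j _ => (hw.memLp_jet.eval j).const_mul _

lemma projN0_mulVec_bdVec {α β : ℕ} (w : ℝ → EuclideanSpace ℝ (Fin β)) :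
    projN0 ℝ α β *ᵥ bdVec α w = jet α w 0 := by
  simp [projN0, bdVec, fromCols_mulVec]

lemma projN1_mulVec_bdVec {α β : ℕ} (w : ℝ → EuclideanSpace ℝ (Fin β)) :
    projN1 ℝ α β *ᵥ bdVec α w = jet α w 1 := by
  simp [projN1, bdVec, fromCols_mulVec]

lemma evalMat_projN (α β : ℕ) (x : ℝ) : evalMat (projN ℝ[X] α β) x = projN ℝ α β := by
  ext p j
  by_cases h : j = (p.1.castSucc, p.2) <;> simp [projN, h]

lemma evalMat_projNd (α β : ℕ) (x : ℝ) : evalMat (projNd ℝ[X] α β) x = projNd ℝ α β := by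
  ext p j
  by_cases h : j = (p.1.succ, p.2) <;> simp [projNd, h]

lemma evalMat_one {n : Type} [DecidableEq n] (x : ℝ) : evalMat (1 : Matrix n n ℝ[X]) x = 1 := by
  ext i j
  by_cases h : i = j <;> simp [h, Matrix.one_apply]

lemma evalMat_projN0 (α β : ℕ) (x : ℝ) : evalMat (projN0 ℝ[X] α β) x = projN0 ℝ α β := by
  rw [projN0, evalMat_fromCols, evalMat_zero, evalMat_one, projN0]

lemma evalMat_projN1 (α β : ℕ) (x : ℝ) : evalMat (projN1 ℝ[X] α β) x = projN1 ℝ α β := by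
  rw [projN1, evalMat_fromCols, evalMat_zero, evalMat_one, projN1]

lemma dotProduct_transpose_mulVec' {m n : Type} [Fintype m] [Fintype n] (M : Matrix m n ℝ)
    (u : n → ℝ) (v : m → ℝ) : u ⬝ᵥ Mᵀ *ᵥ v = (M *ᵥ u) ⬝ᵥ v := by
  rw [dotProduct_transpose_mulVec, dotProduct_comm]

/-! ### The slack matrices contribute nothing -/

section Slack

variable {α β : ℕ} {w : ℝ → EuclideanSpace ℝ (Fin β)}

/-- `w̄_α(x)`. -/
def barVec (α : ℕ) (w : ℝ → EuclideanSpace ℝ (Fin β)) (x : ℝ) : BarIdx α β → ℝ :=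
  Sum.elim (jet (α + 1) w x) (bdVec α w)

lemma MemH.memLp_barVec (hw : MemH α w) : MemLp (barVec α w) 2 μI := by
  refine memLp_pi_iff.2 fun i => ?_
  rcases i with i | i
  · exact hw.memLp_jet.eval i
  · exact memLp_const _

/-- With `g = w_{α-1}` and `b = w_α^b`, the upper blocks give the derivative of `gᵀ K1 g + gᵀ K2 b`,
and the constant lower right block subtracts the resulting boundary terms. -/
lemma integral_matKb (hw : MemH α w) (K1 : Matrix (JetIdx α β) (JetIdx α β) ℝ[X])
    (K2 : Matrix (JetIdx α β) (BdIdx α β) ℝ[X]) :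
    ∫ x, barVec α w x ⬝ᵥ evalMat (matKb K1 K2) x *ᵥ barVec α w x ∂μI = 0 := by
  have h1 := HasACDeriv.dotProduct_mulVec hw.hasACDeriv_jet
    (M := fun x => evalMat K1 x) (M' := fun x => evalMat (K1.map derivative) x)
    (fun i j => HasACDeriv.polynomial (K1 i j)) hw.hasACDeriv_jet
  have h2 := HasACDeriv.dotProduct_mulVec hw.hasACDeriv_jet
    (M := fun x => evalMat K2 x) (M' := fun x => evalMat (K2.map derivative) x)
    (v := fun _ => bdVec α w) (v' := fun _ => 0)
    (fun i j => HasACDeriv.polynomial (K2 i j)) fun j => HasACDeriv.const _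
  have h3 := h1.add h2
  set c : ℝ := jet α w 0 ⬝ᵥ evalMat K1 0 *ᵥ jet α w 0 - jet α w 1 ⬝ᵥ evalMat K1 1 *ᵥ jet α w 1
    + jet α w 0 ⬝ᵥ evalMat K2 0 *ᵥ bdVec α w - jet α w 1 ⬝ᵥ evalMat K2 1 *ᵥ bdVec α w with hc
  -- The constant block is the derivative of `c x`. By the choice of `c` the whole primitive takes
  -- equal values at `0` and `1`.
  have h4 := h3.add (HasACDeriv.polynomial (c • X))
  have h5 := h4.integral_eq
  refine Eq.trans (integral_congr_ae (.of_forall fun x => ?_)) (h5.trans ?_)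
  · simp only [barVec, matKb, evalMat_fromBlocks, sumElim_dotProduct_fromBlocks, evalMat_mul,
      evalMat_add, evalMat_transpose, evalMat_projN, evalMat_projNd, evalMat_zero, evalMat_map_C,
      Matrix.mul_assoc, ← mulVec_mulVec, dotProduct_transpose_mulVec', add_mulVec, sub_mulVec,
      dotProduct_add, dotProduct_sub, projN_mulVec_jet, projN0_mulVec_bdVec, projN1_mulVec_bdVec,
      zero_mulVec, mulVec_zero, dotProduct_zero, derivative_smul, derivative_X, eval_smul,
      eval_one, smul_eq_mul, hc]
    ring
  · simp only [hc, eval_smul, eval_X, smul_eq_mul]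
    ring

end Slack

lemma integrable_fun_sub {E : Type} [MeasurableSpace E] {μ : Measure E} {f g : E → ℝ}
    (hf : Integrable f μ) (hg : Integrable g μ) : Integrable (fun x => f x - g x) μ :=
  hf.sub hg

/-! ### Bivariate polynomial matrices -/

section Bivariate

variable {m n : Type}

lemma continuous_evalMat₂_comp {E : Type} [TopologicalSpace E]
    (H : Matrix m n (MvPolynomial (Fin 2) ℝ)) {a b : E → ℝ} (ha : Continuous a)
    (hb : Continuous b) (i : m) (j : n) : Continuous fun q => evalMat₂ H (a q) (b q) i j := by
  have : Continuous fun q => (![a q, b q] : Fin 2 → ℝ) :=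
    continuous_pi fun k => by fin_cases k <;> simpa
  exact (MvPolynomial.continuous_eval (H i j)).comp this

lemma continuous_evalMat₂ (H : Matrix m n (MvPolynomial (Fin 2) ℝ)) (i : m) (j : n) :
    Continuous fun p : ℝ × ℝ => evalMat₂ H p.1 p.2 i j :=
  continuous_evalMat₂_comp H continuous_fst continuous_snd i j

lemma evalMat_substMat (H : Matrix m n (MvPolynomial (Fin 2) ℝ)) (p q : ℝ[X]) (x : ℝ) :
    evalMat (substMat H p q) x = evalMat₂ H (p.eval x) (q.eval x) := by
  ext i j
  simp only [evalMat, substMat, evalMat₂, map_apply]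
  induction H i j using MvPolynomial.induction_on with
  | C a => simp
  | add a b ha hb => simp [ha, hb]
  | mul_X a k ha => fin_cases k <;> simp [ha]

lemma hasACDeriv_eval_snd (p : MvPolynomial (Fin 2) ℝ) (x : ℝ) :
    HasACDeriv (fun y => MvPolynomial.eval ![x, y] p)
      fun y => MvPolynomial.eval ![x, y] (MvPolynomial.pderiv 1 p) := by
  induction p using MvPolynomial.induction_on with
  | C a => simpa using HasACDeriv.const a
  | add a b ha hb => simpa using ha.add hb
  | mul_X a k ha =>
    fin_cases k
    · have := ha.mul (HasACDeriv.const x)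
      simpa [mul_comm] using this
    · have h := HasACDeriv.polynomial X
      have := ha.mul h
      simpa [mul_comm, add_comm] using this

lemma hasACDeriv_eval_fst (p : MvPolynomial (Fin 2) ℝ) (y : ℝ) :
    HasACDeriv (fun x => MvPolynomial.eval ![x, y] p)
      fun x => MvPolynomial.eval ![x, y] (MvPolynomial.pderiv 0 p) := by
  induction p using MvPolynomial.induction_on with
  | C a => simpa using HasACDeriv.const a
  | add a b ha hb => simpa using ha.add hb
  | mul_X a k ha =>
    fin_cases k
    · have h := HasACDeriv.polynomial X
      have := ha.mul h
      simpa [mul_comm, add_comm] using this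
    · have := ha.mul (HasACDeriv.const y)
      simpa [mul_comm] using this

end Bivariate

/-! ### Slack terms on the triangle and from the boundary conditions -/

section Slack

variable {α β : ℕ} {w : ℝ → EuclideanSpace ℝ (Fin β)}

lemma integral_tri_eq {Φ : ℝ × ℝ → ℝ} (hΦ : Integrable Φ (μI.prod μI)) :
    ∫ p, Φ p ∂μTri = ∫ x, ∫ y, {y | y ≤ x}.indicator (fun y => Φ (x, y)) y ∂μI ∂μI := by
  rw [← integral_indicator measurableSet_tri, integral_prod _ (hΦ.indicator measurableSet_tri)]
  rfl

lemma integral_tri_eq_symm {Φ : ℝ × ℝ → ℝ} (hΦ : Integrable Φ (μI.prod μI)) :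
    ∫ p, Φ p ∂μTri = ∫ y, ∫ x, {x | y ≤ x}.indicator (fun x => Φ (x, y)) x ∂μI ∂μI := by
  rw [← integral_indicator measurableSet_tri,
    integral_prod_symm _ (hΦ.indicator measurableSet_tri)]
  rfl

variable (H1 H2 : Matrix (JetIdx α β) (JetIdx α β) (MvPolynomial (Fin 2) ℝ))

/-- For fixed `x` the integrand is the `y`-derivative of `g(x)ᵀ H1(x,y) g(y)`, `g = w_{α-1}`,
integrated over `[0, x]`: the diagonal value minus the value at `y = 0`. -/
lemma integral_tri_deriv_snd (hw : MemH α w) :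
    ∫ p, (jet α w p.1 ⬝ᵥ evalMat₂ (H1.map (MvPolynomial.pderiv 1)) p.1 p.2 *ᵥ jet α w p.2
        + jet α w p.1 ⬝ᵥ evalMat₂ H1 p.1 p.2 *ᵥ (projNd ℝ α β *ᵥ jet (α + 1) w p.2)) ∂μTri
      = ∫ x, (jet α w x ⬝ᵥ evalMat₂ H1 x x *ᵥ jet α w x
        - jet α w x ⬝ᵥ evalMat₂ H1 x 0 *ᵥ jet α w 0) ∂μI := by
  rw [integral_tri_eq ((integrable_prod_dotProduct_mulVec hw.memLp_jet_lower hw.memLp_jet_lower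
    (continuous_evalMat₂ _)).fun_add (integrable_prod_dotProduct_mulVec hw.memLp_jet_lower
      hw.memLp_projNd_jet (continuous_evalMat₂ _)))]
  refine integral_congr_ae ?_
  filter_upwards [ae_mem_Icc] with x hx
  have h := HasACDeriv.dotProduct_mulVec (u := fun _ => jet α w x) (u' := fun _ => 0)
    (M := fun y => evalMat₂ H1 x y)
    (M' := fun y => evalMat₂ (H1.map (MvPolynomial.pderiv 1)) x y)
    (fun i => HasACDeriv.const _) (fun i j => hasACDeriv_eval_snd (H1 i j) x) hw.hasACDeriv_jet
  simpa using h.integral_indicator_le hx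

/-- The same with the roles exchanged: for fixed `y` an `x`-derivative is integrated over `[y, 1]`.
-/
lemma integral_tri_deriv_fst (hw : MemH α w) :
    ∫ p, (jet α w p.1 ⬝ᵥ evalMat₂ (H2.map (MvPolynomial.pderiv 0)) p.1 p.2 *ᵥ jet α w p.2
        + (projNd ℝ α β *ᵥ jet (α + 1) w p.1) ⬝ᵥ evalMat₂ H2 p.1 p.2 *ᵥ jet α w p.2) ∂μTri
      = ∫ x, (jet α w 1 ⬝ᵥ evalMat₂ H2 1 x *ᵥ jet α w x
        - jet α w x ⬝ᵥ evalMat₂ H2 x x *ᵥ jet α w x) ∂μI := by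
  rw [integral_tri_eq_symm ((integrable_prod_dotProduct_mulVec hw.memLp_jet_lower
    hw.memLp_jet_lower (continuous_evalMat₂ _)).fun_add (integrable_prod_dotProduct_mulVec
      hw.memLp_projNd_jet hw.memLp_jet_lower (continuous_evalMat₂ _)))]
  refine integral_congr_ae ?_
  filter_upwards [ae_mem_Icc] with y hy
  have h := HasACDeriv.dotProduct_mulVec (v := fun _ => jet α w y) (v' := fun _ => 0)
    (M := fun x => evalMat₂ H2 x y)
    (M' := fun x => evalMat₂ (H2.map (MvPolynomial.pderiv 0)) x y)
    hw.hasACDeriv_jet (fun i j => hasACDeriv_eval_fst (H2 i j) y) (fun i => HasACDeriv.const _)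
  simpa [add_comm] using h.integral_indicator_ge hy

lemma dotProduct_matHbar (w : ℝ → EuclideanSpace ℝ (Fin β)) (x y : ℝ) :
    2 * (jet (α + 1) w x ⬝ᵥ matHbar H1 H2 x y *ᵥ jet (α + 1) w y)
      = (jet α w x ⬝ᵥ evalMat₂ (H1.map (MvPolynomial.pderiv 1)) x y *ᵥ jet α w y
        + jet α w x ⬝ᵥ evalMat₂ H1 x y *ᵥ (projNd ℝ α β *ᵥ jet (α + 1) w y))
      - (jet α w x ⬝ᵥ evalMat₂ (H2.map (MvPolynomial.pderiv 0)) x y *ᵥ jet α w y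
        + (projNd ℝ α β *ᵥ jet (α + 1) w x) ⬝ᵥ evalMat₂ H2 x y *ᵥ jet α w y) := by
  simp only [matHbar, add_mulVec, sub_mulVec, smul_mulVec, dotProduct_add, dotProduct_sub,
    dotProduct_smul, smul_eq_mul, Matrix.mul_assoc, ← mulVec_mulVec,
    dotProduct_transpose_mulVec', projN_mulVec_jet]
  ring

lemma dotProduct_matHb (w : ℝ → EuclideanSpace ℝ (Fin β)) (x : ℝ) :
    barVec α w x ⬝ᵥ evalMat (matHb H1 H2) x *ᵥ barVec α w x
      = -((jet α w x ⬝ᵥ evalMat₂ H1 x x *ᵥ jet α w x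
        - jet α w x ⬝ᵥ evalMat₂ H1 x 0 *ᵥ jet α w 0)
        - (jet α w 1 ⬝ᵥ evalMat₂ H2 1 x *ᵥ jet α w x
        - jet α w x ⬝ᵥ evalMat₂ H2 x x *ᵥ jet α w x)) := by
  simp only [barVec, matHb, evalMat_fromBlocks, sumElim_dotProduct_fromBlocks, evalMat_mul,
    evalMat_add, evalMat_neg, evalMat_transpose, evalMat_projN, evalMat_projN0, evalMat_projN1,
    evalMat_substMat, evalMat_zero, Matrix.mul_assoc, ← mulVec_mulVec,
    dotProduct_transpose_mulVec', add_mulVec, neg_mulVec, dotProduct_add, dotProduct_neg,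
    projN_mulVec_jet, projN0_mulVec_bdVec, projN1_mulVec_bdVec, zero_mulVec, dotProduct_zero,
    eval_X, eval_zero, eval_one]
  ring

/-- The divergence theorem on the triangle: `2 H̄` is the divergence-type integrand, and `H_b` is
minus its flux through the diagonal and the sides `y = 0` and `x = 1`. -/
lemma integral_matHb (hw : MemH α w) :
    ∫ x, barVec α w x ⬝ᵥ evalMat (matHb H1 H2) x *ᵥ barVec α w x ∂μI
      + 2 * ∫ p, jet (α + 1) w p.1 ⬝ᵥ matHbar H1 H2 p.1 p.2 *ᵥ jet (α + 1) w p.2 ∂μTri = 0 := by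
  have hg := hw.memLp_jet_lower
  have hg' := hw.memLp_projNd_jet
  have i1 := integrable_tri_dotProduct_mulVec hg hg
    (continuous_evalMat₂ (H1.map (MvPolynomial.pderiv 1)))
  have i2 := integrable_tri_dotProduct_mulVec hg hg' (continuous_evalMat₂ H1)
  have i3 := integrable_tri_dotProduct_mulVec hg hg
    (continuous_evalMat₂ (H2.map (MvPolynomial.pderiv 0)))
  have i4 := integrable_tri_dotProduct_mulVec hg' hg (continuous_evalMat₂ H2)
  have h0 : MemLp (fun _ : ℝ => jet α w 0) 2 μI := memLp_const _
  have h1 : MemLp (fun _ : ℝ => jet α w 1) 2 μI := memLp_const _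
  have j1 := integrable_dotProduct_mulVec hg hg
    (continuous_evalMat₂_comp H1 continuous_id' continuous_id')
  have j2 := integrable_dotProduct_mulVec hg h0
    (continuous_evalMat₂_comp H1 continuous_id' (continuous_const (y := 0)))
  have j3 := integrable_dotProduct_mulVec h1 hg
    (continuous_evalMat₂_comp H2 (continuous_const (y := 1)) continuous_id')
  have j4 := integrable_dotProduct_mulVec hg hg
    (continuous_evalMat₂_comp H2 continuous_id' continuous_id')
  have e1 := integral_tri_deriv_snd H1 hw
  have e2 := integral_tri_deriv_fst H2 hw
  rw [integral_add i1 i2, integral_sub j1 j2] at e1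
  rw [integral_add i3 i4, integral_sub j3 j4] at e2
  rw [← integral_const_mul]
  simp_rw [dotProduct_matHbar, dotProduct_matHb]
  rw [integral_neg, integral_sub (integrable_fun_sub j1 j2) (integrable_fun_sub j3 j4),
    integral_sub j1 j2, integral_sub j3 j4, integral_sub (i1.fun_add i2) (i3.fun_add i4), integral_add i1 i2,
    integral_add i3 i4]
  linarith

lemma dotProduct_matBb {F : Matrix (JetIdx α β) (BdIdx α β) ℝ} (hF : F *ᵥ bdVec α w = 0)
    (B1 : Matrix (JetIdx (α + 1) β) (JetIdx α β) ℝ[X])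
    (B2 : Matrix (BdIdx α β) (JetIdx α β) ℝ[X]) (x : ℝ) :
    barVec α w x ⬝ᵥ evalMat (matBb F B1 B2) x *ᵥ barVec α w x = 0 := by
  simp only [barVec, matBb, evalMat_fromBlocks, sumElim_dotProduct_fromBlocks, evalMat_mul,
    evalMat_map_C, evalMat_zero, ← mulVec_mulVec, hF, mulVec_zero, zero_mulVec, dotProduct_zero,
    add_zero]

end Slack

/-! ### Dissipation of the Lyapunov functional -/

section Pad

variable {α β : ℕ} {n : Type}

lemma evalMat_padRows (M : Matrix (Fin β) n ℝ[X]) (x : ℝ) :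
    evalMat (padRows α M) x = padRows α (evalMat M x) := by
  ext p j
  by_cases h : p.1 = 0 <;> simp [padRows, h]

lemma evalMat_padSquare (M : Matrix (Fin β) (Fin β) ℝ[X]) (x : ℝ) :
    evalMat (padSquare α M) x = padSquare α (evalMat M x) := by
  ext p q
  by_cases h : p.1 = 0 ∧ q.1 = 0 <;> simp [padSquare, h]

lemma dotProduct_padRows [Fintype n] (M : Matrix (Fin β) n ℝ) (u : JetIdx (α + 1) β → ℝ)
    (v : n → ℝ) : u ⬝ᵥ padRows α M *ᵥ v = (fun i => u (0, i)) ⬝ᵥ M *ᵥ v := by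
  simp only [dotProduct_mulVec_eq_sum, Fintype.sum_prod_type]
  rw [Finset.sum_eq_single 0]
  · simp [padRows]
  · intro b _ hb
    simp [padRows, hb]
  · simp

lemma dotProduct_padSquare (M : Matrix (Fin β) (Fin β) ℝ) (u v : JetIdx (α + 1) β → ℝ) :
    u ⬝ᵥ padSquare α M *ᵥ v = (fun i => u (0, i)) ⬝ᵥ M *ᵥ fun i => v (0, i) := by
  simp only [dotProduct_mulVec_eq_sum, Fintype.sum_prod_type]
  rw [Finset.sum_eq_single 0]
  · refine Finset.sum_congr rfl fun i _ => ?_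
    rw [Finset.sum_eq_single 0]
    · simp [padSquare]
    · intro b _ hb
      simp [padSquare, hb]
    · simp
  · intro b _ hb
    simp [padSquare, hb]
  · simp

end Pad

/-- The symmetric bilinear form
`∫ fᵀ Tb g dx + ∬_{y ≤ x} (f(x)ᵀ K(x,y) g(y) + g(x)ᵀ K(x,y) f(y)) dy dx`. -/
def lyapunovForm {β : ℕ} (Tb : Matrix (Fin β) (Fin β) ℝ[X])
    (K : ℝ → ℝ → Matrix (Fin β) (Fin β) ℝ) (f g : ℝ → Fin β → ℝ) : ℝ :=
  ∫ x, f x ⬝ᵥ evalMat Tb x *ᵥ g x ∂μI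
    + ∫ p, (f p.1 ⬝ᵥ K p.1 p.2 *ᵥ g p.2 + g p.1 ⬝ᵥ K p.1 p.2 *ᵥ f p.2) ∂μTri

section Dissipation

variable {α β : ℕ} (A : Matrix (Fin β) (JetIdx (α + 1) β) ℝ[X]) (δ : ℝ)
  (Tb : Matrix (Fin β) (Fin β) ℝ[X])

/-- `U_b` encodes the multiplier part of `-(q(w, A w_α) + δ q(w, w))`. -/
lemma dotProduct_matUb (w : ℝ → EuclideanSpace ℝ (Fin β)) (x : ℝ) :
    barVec α w x ⬝ᵥ evalMat (matUb A δ Tb) x *ᵥ barVec α w x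
      = -(dx 0 w x ⬝ᵥ evalMat Tb x *ᵥ (evalMat A x *ᵥ jet (α + 1) w x))
        - δ * (dx 0 w x ⬝ᵥ evalMat Tb x *ᵥ dx 0 w x) := by
  have h0 : (fun i => jet (α + 1) w x (0, i)) = dx 0 w x := rfl
  rw [matUb, evalMat_sub, evalMat_neg, sub_mulVec, dotProduct_sub, neg_mulVec, dotProduct_neg,
    dotProduct_evalMat_He, dotProduct_evalMat_He]
  simp only [barVec, evalMat_fromBlocks, sumElim_dotProduct_fromBlocks, evalMat_zero, zero_mulVec,
    dotProduct_zero, add_zero, evalMat_padRows, evalMat_padSquare, dotProduct_padRows,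
    dotProduct_padSquare, evalMat_mul, evalMat_real_smul, smul_mulVec, dotProduct_smul,
    smul_eq_mul, mulVec_mulVec, h0]

/-- `Ū` encodes the kernel part of the same quantity. The factor 2 is that of an integral folded
onto the triangle. -/
lemma dotProduct_matUbar (K : ℝ → ℝ → Matrix (Fin β) (Fin β) ℝ)
    (w : ℝ → EuclideanSpace ℝ (Fin β)) (x y : ℝ) :
    2 * (jet (α + 1) w x ⬝ᵥ matUbar A δ K x y *ᵥ jet (α + 1) w y)
      = -((dx 0 w x ⬝ᵥ K x y *ᵥ (evalMat A y *ᵥ jet (α + 1) w y)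
          + (evalMat A x *ᵥ jet (α + 1) w x) ⬝ᵥ K x y *ᵥ dx 0 w y)
        + δ * (dx 0 w x ⬝ᵥ K x y *ᵥ dx 0 w y + dx 0 w x ⬝ᵥ K x y *ᵥ dx 0 w y)) := by
  have h0 : ∀ x, (fun i => jet (α + 1) w x (0, i)) = dx 0 w x := fun _ => rfl
  simp only [matUbar, sub_mulVec, neg_mulVec, smul_mulVec, add_mulVec, dotProduct_sub,
    dotProduct_neg, dotProduct_add, dotProduct_smul, smul_eq_mul, dotProduct_padSquare,
    dotProduct_transpose_mulVec, dotProduct_padRows, ← mulVec_mulVec, h0]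
  ring

end Dissipation

/-- The Lyapunov form dissipates along the generator, on states in `ℬ`. -/
lemma lyapunovForm_dissipation {α β d : ℕ} {δ : ℝ}
    {A : Matrix (Fin β) (JetIdx (α + 1) β) ℝ[X]} {F : Matrix (JetIdx α β) (BdIdx α β) ℝ}
    {Rb : Matrix (BarIdx α β) (BarIdx α β) ℝ[X]}
    {R12 R13 : Matrix (JetIdx (α + 1) β) (JetIdx (α + 1) β × MonIdx d) ℝ[X]}
    {R22 R23 R33 : Matrix (JetIdx (α + 1) β × MonIdx d) (JetIdx (α + 1) β × MonIdx d) ℝ}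
    (hR22 : R22.IsSymm) (hR33 : R33.IsSymm)
    {Tb : Matrix (Fin β) (Fin β) ℝ[X]} {T : ℝ → ℝ → Matrix (Fin β) (Fin β) ℝ}
    (hTc : ∀ i j, Continuous fun p : ℝ × ℝ => T p.1 p.2 i j)
    {SR : Matrix
      (BarIdx α β ⊕ ((JetIdx (α + 1) β × MonIdx d) ⊕ (JetIdx (α + 1) β × MonIdx d)))
      (BarIdx α β ⊕ ((JetIdx (α + 1) β × MonIdx d) ⊕ (JetIdx (α + 1) β × MonIdx d))) ℝ[X]}
    {S : Matrix (BarIdx α β) (BarIdx α β) ℝ[X]}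
    {K1 : Matrix (JetIdx α β) (JetIdx α β) ℝ[X]} {K2 : Matrix (JetIdx α β) (BdIdx α β) ℝ[X]}
    {H1 H2 : Matrix (JetIdx α β) (JetIdx α β) (MvPolynomial (Fin 2) ℝ)}
    {B1 : Matrix (JetIdx (α + 1) β) (JetIdx α β) ℝ[X]}
    {B2 : Matrix (BdIdx α β) (JetIdx α β) ℝ[X]}
    (hR : IsSOS (matR Rb R12 R13 R22 R23 R33 - omega • SR)) (hSR : IsSOS SR)
    (hP : IsSOS (He (matUb A δ Tb + matKb K1 K2 + matHb H1 H2 + matBb F B1 B2)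
      - Rb - omega • S))
    (hS : IsSOS S)
    (hker : ∀ x y : ℝ, matUbar A δ T x y + matHbar H1 H2 x y
      - kernel R12 R13 R22 R23 R33 x y = 0)
    {w : ℝ → EuclideanSpace ℝ (Fin β)} (hw : MemB F w)
    (hA : MemLp (fun x => evalMat A x *ᵥ jet (α + 1) w x) 2 μI) :
    lyapunovForm Tb T (fun x => dx 0 w x) (fun x => evalMat A x *ᵥ jet (α + 1) w x)
      + δ * lyapunovForm Tb T (fun x => dx 0 w x) (fun x => dx 0 w x) ≤ 0 := by
  obtain ⟨hH, hF⟩ := hw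
  have hf := hH.memLp_jet
  have hb := hH.memLp_barVec
  have h0 : MemLp (fun x => (dx 0 w x).ofLp) 2 μI :=
    memLp_pi_iff.2 fun i => hf.eval ((0, i) : JetIdx (α + 1) β)
  -- the quadratic form of `R` is nonnegative
  have hRnn : 0 ≤ ∫ x, barVec α w x ⬝ᵥ evalMat Rb x *ᵥ barVec α w x ∂μI
      + 2 * ∫ p, jet (α + 1) w p.1 ⬝ᵥ kernel R12 R13 R22 R23 R33 p.1 p.2
        *ᵥ jet (α + 1) w p.2 ∂μTri := by
    -- The zero rows of the padded blocks meet the boundary coordinates, so only `w_α` is paired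
    -- with the truncated integrals.
    have key : ∀ (R : Matrix (JetIdx (α + 1) β) (JetIdx (α + 1) β × MonIdx d) ℝ[X]) x v,
        barVec α w x ⬝ᵥ evalMat (fromRows R (0 : Matrix (BdIdx α β) _ ℝ[X])) x *ᵥ v
          = jet (α + 1) w x ⬝ᵥ evalMat R x *ᵥ v := by
      intro R x v
      simp only [barVec, evalMat_fromRows, fromRows_mulVec, evalMat_zero, zero_mulVec,
        sumElim_dotProduct_sumElim, dotProduct_zero, add_zero]
    rw [← integral_blockMat_eq R12 R13 R22 R23 R33 Rb _ _ hf hb hR22 hR33 (key R12) (key R13)]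
    refine integral_nonneg_of_ae ?_
    filter_upwards [ae_mem_Icc] with x hx
    exact dotProduct_nonneg_of_isSOS_sub hR hSR hx _
  -- the pointwise matrix inequality, integrated
  have iU := integrable_dotProduct_mulVec hb hb (continuous_evalMat (matUb A δ Tb))
  have iK := integrable_dotProduct_mulVec hb hb (continuous_evalMat (matKb K1 K2))
  have iH := integrable_dotProduct_mulVec hb hb (continuous_evalMat (matHb H1 H2))
  have iR := integrable_dotProduct_mulVec hb hb (continuous_evalMat Rb)
  have hPnn : 0 ≤ ∫ x, barVec α w x ⬝ᵥ evalMat (matUb A δ Tb) x *ᵥ barVec α w x ∂μI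
      + ∫ x, barVec α w x ⬝ᵥ evalMat (matKb K1 K2) x *ᵥ barVec α w x ∂μI
      + ∫ x, barVec α w x ⬝ᵥ evalMat (matHb H1 H2) x *ᵥ barVec α w x ∂μI
      - ∫ x, barVec α w x ⬝ᵥ evalMat Rb x *ᵥ barVec α w x ∂μI := by
    rw [← integral_add iU iK, ← integral_add (iU.fun_add iK) iH,
      ← integral_sub ((iU.fun_add iK).fun_add iH) iR]
    refine integral_nonneg_of_ae ?_
    filter_upwards [ae_mem_Icc] with x hx
    have h := dotProduct_nonneg_of_isSOS_sub hP hS hx (barVec α w x)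
    rw [evalMat_sub, sub_mulVec, dotProduct_sub, dotProduct_evalMat_He] at h
    simp only [evalMat_add, add_mulVec, dotProduct_add, dotProduct_matBb hF, add_zero] at h
    exact h
  rw [integral_matKb hH] at hPnn
  have hHz := integral_matHb H1 H2 hH
  -- the kernels
  have iT1 := integrable_tri_dotProduct_mulVec h0 hA hTc
  have iT2 := integrable_tri_dotProduct_mulVec hA h0 hTc
  have iT3 := integrable_tri_dotProduct_mulVec h0 h0 hTc
  have iT := ((iT1.fun_add iT2).fun_add ((iT3.fun_add iT3).const_mul δ)).neg
  have iUbar : Integrable (fun p : ℝ × ℝ => 2 * (jet (α + 1) w p.1 ⬝ᵥ matUbar A δ T p.1 p.2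
      *ᵥ jet (α + 1) w p.2)) μTri :=
    iT.congr (.of_forall fun p => (dotProduct_matUbar A δ T w p.1 p.2).symm)
  have iRbar := (integrable_tri_dotProduct_mulVec hf hf
    (continuous_kernel R12 R13 R22 R23 R33)).const_mul 2
  -- The identity `H̄ = R̄ - Ū` tested on `w_α`; each difference in parentheses is the triangle part
  -- of a Lyapunov form.
  have hbar : 2 * ∫ p, jet (α + 1) w p.1 ⬝ᵥ matHbar H1 H2 p.1 p.2 *ᵥ jet (α + 1) w p.2 ∂μTri
      = 2 * ∫ p, jet (α + 1) w p.1 ⬝ᵥ kernel R12 R13 R22 R23 R33 p.1 p.2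
        *ᵥ jet (α + 1) w p.2 ∂μTri
      + (lyapunovForm Tb T (fun x => dx 0 w x) (fun x => evalMat A x *ᵥ jet (α + 1) w x)
        - ∫ x, dx 0 w x ⬝ᵥ evalMat Tb x *ᵥ (evalMat A x *ᵥ jet (α + 1) w x) ∂μI)
      + δ * (lyapunovForm Tb T (fun x => dx 0 w x) (fun x => dx 0 w x)
        - ∫ x, dx 0 w x ⬝ᵥ evalMat Tb x *ᵥ dx 0 w x ∂μI) := by
    have hU : ∫ p, 2 * (jet (α + 1) w p.1 ⬝ᵥ matUbar A δ T p.1 p.2 *ᵥ jet (α + 1) w p.2) ∂μTri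
        = -((lyapunovForm Tb T (fun x => dx 0 w x) (fun x => evalMat A x *ᵥ jet (α + 1) w x)
        - ∫ x, dx 0 w x ⬝ᵥ evalMat Tb x *ᵥ (evalMat A x *ᵥ jet (α + 1) w x) ∂μI)
      + δ * (lyapunovForm Tb T (fun x => dx 0 w x) (fun x => dx 0 w x)
        - ∫ x, dx 0 w x ⬝ᵥ evalMat Tb x *ᵥ dx 0 w x ∂μI)) := by
      simp_rw [dotProduct_matUbar]
      rw [integral_neg, integral_add (iT1.fun_add iT2) ((iT3.fun_add iT3).const_mul δ),
        integral_const_mul]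
      simp only [lyapunovForm]
      ring
    rw [← integral_const_mul, ← integral_const_mul, add_assoc, ← neg_eq_iff_eq_neg.2 hU,
      ← sub_eq_add_neg, ← integral_sub iRbar iUbar]
    refine integral_congr_ae (.of_forall fun p => ?_)
    have h := hker p.1 p.2
    have h1 : matHbar H1 H2 p.1 p.2
        = kernel R12 R13 R22 R23 R33 p.1 p.2 - matUbar A δ T p.1 p.2 :=
      eq_sub_of_add_eq' (sub_eq_zero.1 h)
    simp only [h1, sub_mulVec, dotProduct_sub]
    ring
  have hUb : ∫ x, barVec α w x ⬝ᵥ evalMat (matUb A δ Tb) x *ᵥ barVec α w x ∂μI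
      = -(∫ x, dx 0 w x ⬝ᵥ evalMat Tb x *ᵥ (evalMat A x *ᵥ jet (α + 1) w x) ∂μI)
        - δ * ∫ x, dx 0 w x ⬝ᵥ evalMat Tb x *ᵥ dx 0 w x ∂μI := by
    simp_rw [dotProduct_matUb]
    rw [integral_sub (integrable_dotProduct_mulVec h0 hA (continuous_evalMat Tb)).fun_neg
      ((integrable_dotProduct_mulVec h0 h0 (continuous_evalMat Tb)).const_mul δ), integral_neg,
      integral_const_mul]
  -- The integrated inequality bounds the dissipation below by `ℛ(w) ≥ 0`; the `H_b` and `H̄`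
  -- contributions cancel.
  linarith

/-! ### The Lyapunov form on `L₂` -/

section Bounds

variable {β : ℕ}

lemma memLp_coords (f : L2 β) : MemLp (fun x => (f x).ofLp) 2 μI :=
  memLp_pi_iff.2 fun i => (Lp.memLp f).eval_piLp i

lemma integral_norm_sq_eq (f : L2 β) : ∫ x, ‖f x‖ ^ 2 ∂μI = ‖f‖ ^ 2 := by
  rw [← real_inner_self_eq_norm_sq, L2.inner_def]
  simp_rw [real_inner_self_eq_norm_sq]

lemma integral_norm_mul_norm_le (f g : L2 β) : ∫ x, ‖f x‖ * ‖g x‖ ∂μI ≤ ‖f‖ * ‖g‖ := by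
  have hpq : (2 : ℝ).HolderConjugate 2 := Real.HolderConjugate.two_two
  have h := integral_mul_norm_le_Lp_mul_Lq (μ := μI) hpq (f := f) (g := g)
    (by simpa using Lp.memLp f) (by simpa using Lp.memLp g)
  have hs : ∀ f : L2 β, (∫ x, ‖f x‖ ^ (2 : ℝ) ∂μI) ^ (1 / 2 : ℝ) = ‖f‖ := by
    intro f
    simp_rw [Real.rpow_two]
    rw [integral_norm_sq_eq, ← Real.sqrt_eq_rpow, Real.sqrt_sq (norm_nonneg _)]
  rwa [hs, hs] at h

/-- Cauchy–Schwarz against the constant one, on a space of mass one. -/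
lemma integral_norm_le (f : L2 β) : ∫ x, ‖f x‖ ∂μI ≤ ‖f‖ := by
  have hpq : (2 : ℝ).HolderConjugate 2 := Real.HolderConjugate.two_two
  have h := integral_mul_norm_le_Lp_mul_Lq (μ := μI) hpq (f := fun x => ‖f x‖)
    (g := fun _ => (1 : ℝ)) (by simpa using (Lp.memLp f).norm) (memLp_const _)
  simp_rw [Real.rpow_two, norm_norm] at h
  rw [integral_norm_sq_eq, ← Real.sqrt_eq_rpow, Real.sqrt_sq (norm_nonneg _)] at h
  simpa using h

lemma integrable_norm (f : L2 β) : Integrable (fun x => ‖f x‖) μI :=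
  ((Lp.memLp f).integrable (by norm_num)).norm

lemma integrable_norm_mul_norm (f g : L2 β) : Integrable (fun x => ‖f x‖ * ‖g x‖) μI :=
  (Lp.memLp f).norm.integrable_mul (Lp.memLp g).norm

lemma integral_tri_norm_mul_norm_le (f g : L2 β) :
    ∫ p, ‖f p.1‖ * ‖g p.2‖ ∂μTri ≤ ‖f‖ * ‖g‖ := by
  calc ∫ p, ‖f p.1‖ * ‖g p.2‖ ∂μTri
      ≤ ∫ p, ‖f p.1‖ * ‖g p.2‖ ∂(μI.prod μI) :=
        setIntegral_le_integral ((integrable_norm f).mul_prod (integrable_norm g))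
          (.of_forall fun p => by positivity)
    _ = (∫ x, ‖f x‖ ∂μI) * ∫ x, ‖g x‖ ∂μI :=
        integral_prod_mul (fun x => ‖f x‖) fun x => ‖g x‖
    _ ≤ ‖f‖ * ‖g‖ := mul_le_mul (integral_norm_le f) (integral_norm_le g)
        (integral_nonneg fun _ => norm_nonneg _) (norm_nonneg _)

lemma abs_dotProduct_mulVec_le (M : Matrix (Fin β) (Fin β) ℝ)
    (u v : EuclideanSpace ℝ (Fin β)) :
    |u.ofLp ⬝ᵥ M *ᵥ v.ofLp| ≤ (∑ i, ∑ j, |M i j|) * (‖u‖ * ‖v‖) := by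
  rw [dotProduct_mulVec_eq_sum, Finset.sum_mul]
  refine (Finset.abs_sum_le_sum_abs _ _).trans (Finset.sum_le_sum fun i _ => ?_)
  rw [Finset.sum_mul]
  refine (Finset.abs_sum_le_sum_abs _ _).trans (Finset.sum_le_sum fun j _ => ?_)
  rw [abs_mul, abs_mul]
  have h1 : |u i| ≤ ‖u‖ := PiLp.norm_apply_le u i
  have h2 : |v j| ≤ ‖v‖ := PiLp.norm_apply_le v j
  calc |u i| * (|M i j| * |v j|) = |M i j| * (|u i| * |v j|) := by ring
    _ ≤ _ := by gcongr

lemma exists_bound_integral (M : Matrix (Fin β) (Fin β) ℝ[X]) :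
    ∃ c, ∀ f g : L2 β,
      |∫ x, (f x).ofLp ⬝ᵥ evalMat M x *ᵥ (g x).ofLp ∂μI| ≤ c * (‖f‖ * ‖g‖) := by
  obtain ⟨c, hc⟩ := exists_ae_bound (k := fun x => ∑ i, ∑ j, |evalMat M x i j|)
    (continuous_finsetSum _ fun i _ => continuous_finsetSum _ fun j _ =>
      (continuous_evalMat M i j).abs)
  refine ⟨|c|, fun f g => ?_⟩
  rw [← Real.norm_eq_abs]
  refine (norm_integral_le_of_norm_le ((integrable_norm_mul_norm f g).const_mul |c|) ?_).trans ?_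
  · filter_upwards [hc] with x hx
    refine (abs_dotProduct_mulVec_le _ _ _).trans ?_
    gcongr
    exact (le_abs_self _).trans (hx.trans (le_abs_self c))
  · rw [integral_const_mul]
    exact mul_le_mul_of_nonneg_left (integral_norm_mul_norm_le f g) (abs_nonneg c)

lemma exists_bound_integral_tri {K : ℝ → ℝ → Matrix (Fin β) (Fin β) ℝ}
    (hK : ∀ i j, Continuous fun p : ℝ × ℝ => K p.1 p.2 i j) :
    ∃ c, ∀ f g : L2 β,
      |∫ p, (f p.1).ofLp ⬝ᵥ K p.1 p.2 *ᵥ (g p.2).ofLp ∂μTri| ≤ c * (‖f‖ * ‖g‖) := by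
  obtain ⟨c, hc⟩ := exists_ae_prod_bound (k := fun x y => ∑ i, ∑ j, |K x y i j|)
    (continuous_finsetSum _ fun i _ => continuous_finsetSum _ fun j _ => (hK i j).abs)
  refine ⟨|c|, fun f g => ?_⟩
  have hi : Integrable (fun p : ℝ × ℝ => ‖f p.1‖ * ‖g p.2‖) μTri :=
    ((integrable_norm f).mul_prod (integrable_norm g)).restrict
  rw [← Real.norm_eq_abs]
  refine (norm_integral_le_of_norm_le (hi.const_mul |c|) ?_).trans ?_
  · filter_upwards [ae_restrict_of_ae hc] with p hp
    refine (abs_dotProduct_mulVec_le _ _ _).trans ?_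
    gcongr
    exact (le_abs_self _).trans (hp.trans (le_abs_self c))
  · rw [integral_const_mul]
    exact mul_le_mul_of_nonneg_left (integral_tri_norm_mul_norm_le f g) (abs_nonneg c)

end Bounds

section Form

variable {β : ℕ} {Tb : Matrix (Fin β) (Fin β) ℝ[X]} {K : ℝ → ℝ → Matrix (Fin β) (Fin β) ℝ}

lemma ae_tri_fst_snd {p : ℝ → Prop} (h : ∀ᵐ x ∂μI, p x) : ∀ᵐ q ∂μTri, p q.1 ∧ p q.2 :=
  ae_restrict_of_ae ((Measure.quasiMeasurePreserving_fst.ae h).and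
    (Measure.quasiMeasurePreserving_snd.ae h))

/-- Lets the form pass between `L₂` classes and the regular representatives in `ℬ`. -/
lemma lyapunovForm_congr {f f' g g' : ℝ → Fin β → ℝ} (hf : ∀ᵐ x ∂μI, f x = f' x)
    (hg : ∀ᵐ x ∂μI, g x = g' x) : lyapunovForm Tb K f g = lyapunovForm Tb K f' g' := by
  unfold lyapunovForm
  congr 1
  · refine integral_congr_ae ?_
    filter_upwards [hf, hg] with x h1 h2
    rw [h1, h2]
  · refine integral_congr_ae ?_
    filter_upwards [ae_tri_fst_snd hf, ae_tri_fst_snd hg] with p h1 h2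
    rw [h1.1, h1.2, h2.1, h2.2]

lemma lyapunovForm_comm (hTb : Tb.IsSymm) (f g : ℝ → Fin β → ℝ) :
    lyapunovForm Tb K f g = lyapunovForm Tb K g f := by
  unfold lyapunovForm
  have hs : ∀ x, (evalMat Tb x)ᵀ = evalMat Tb x := fun x => by rw [← evalMat_transpose, hTb.eq]
  congr 1
  · refine integral_congr_ae (.of_forall fun x => ?_)
    change f x ⬝ᵥ evalMat Tb x *ᵥ g x = g x ⬝ᵥ evalMat Tb x *ᵥ f x
    rw [← dotProduct_transpose_mulVec, hs]
  · exact integral_congr_ae (.of_forall fun p => add_comm _ _)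

lemma lyapunovForm_add_left (hK : ∀ i j, Continuous fun p : ℝ × ℝ => K p.1 p.2 i j)
    {f f' g : ℝ → Fin β → ℝ} (hf : MemLp f 2 μI) (hf' : MemLp f' 2 μI) (hg : MemLp g 2 μI) :
    lyapunovForm Tb K (fun x => f x + f' x) g
      = lyapunovForm Tb K f g + lyapunovForm Tb K f' g := by
  unfold lyapunovForm
  have i1 := integrable_dotProduct_mulVec hf hg (continuous_evalMat Tb)
  have i2 := integrable_dotProduct_mulVec hf' hg (continuous_evalMat Tb)
  have j1 := (integrable_tri_dotProduct_mulVec hf hg hK).fun_add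
    (integrable_tri_dotProduct_mulVec hg hf hK)
  have j2 := (integrable_tri_dotProduct_mulVec hf' hg hK).fun_add
    (integrable_tri_dotProduct_mulVec hg hf' hK)
  rw [add_add_add_comm, ← integral_add i1 i2, ← integral_add j1 j2]
  simp only [add_dotProduct, mulVec_add, dotProduct_add]
  congr 2
  ext p
  ring

lemma lyapunovForm_smul_left (c : ℝ) (f g : ℝ → Fin β → ℝ) :
    lyapunovForm Tb K (fun x => c • f x) g = c * lyapunovForm Tb K f g := by
  unfold lyapunovForm
  simp only [smul_dotProduct, mulVec_smul, dotProduct_smul, smul_eq_mul, ← mul_add,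
    integral_const_mul]

/-- Bounded multipliers and bounded kernels act boundedly on `L₂`. Continuity is what permits the
chain rule along an `L₂`-differentiable solution. -/
lemma exists_lyapunovForm_continuous (hTb : Tb.IsSymm)
    (hK : ∀ i j, Continuous fun p : ℝ × ℝ => K p.1 p.2 i j) :
    ∃ q : L2 β →L[ℝ] L2 β →L[ℝ] ℝ, ∀ f g : L2 β,
      q f g = lyapunovForm Tb K (fun x => (f x).ofLp) fun x => (g x).ofLp := by
  have hadd : ∀ f f' g : L2 β, lyapunovForm Tb K (fun x => ((f + f' : L2 β) x).ofLp)
      (fun x => (g x).ofLp) = lyapunovForm Tb K (fun x => (f x).ofLp) (fun x => (g x).ofLp)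
        + lyapunovForm Tb K (fun x => (f' x).ofLp) (fun x => (g x).ofLp) := by
    intro f f' g
    rw [← lyapunovForm_add_left hK (memLp_coords f) (memLp_coords f') (memLp_coords g)]
    refine lyapunovForm_congr ?_ (.of_forall fun _ => rfl)
    filter_upwards [Lp.coeFn_add f f'] with x hx
    rw [hx]
    rfl
  have hsmul : ∀ (c : ℝ) (f g : L2 β), lyapunovForm Tb K (fun x => ((c • f : L2 β) x).ofLp)
      (fun x => (g x).ofLp)
        = c * lyapunovForm Tb K (fun x => (f x).ofLp) (fun x => (g x).ofLp) := by
    intro c f g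
    rw [← lyapunovForm_smul_left]
    refine lyapunovForm_congr ?_ (.of_forall fun _ => rfl)
    filter_upwards [Lp.coeFn_smul c f] with x hx
    rw [hx]
    rfl
  obtain ⟨c1, h1⟩ := exists_bound_integral Tb
  obtain ⟨c2, h2⟩ := exists_bound_integral_tri hK
  refine ⟨(LinearMap.mk₂ ℝ (fun f g : L2 β =>
    lyapunovForm Tb K (fun x => (f x).ofLp) fun x => (g x).ofLp) hadd hsmul ?_ ?_).mkContinuous₂
      (c1 + (c2 + c2)) ?_, fun f g => rfl⟩
  -- Linearity in the second argument is inherited from the first by symmetry.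
  · intro f g g'
    rw [lyapunovForm_comm hTb, hadd, lyapunovForm_comm hTb (fun x => (g x).ofLp),
      lyapunovForm_comm hTb (fun x => (g' x).ofLp)]
  · intro c f g
    rw [lyapunovForm_comm hTb, hsmul, lyapunovForm_comm hTb, smul_eq_mul]
  · intro f g
    change |lyapunovForm Tb K _ _| ≤ _
    unfold lyapunovForm
    rw [integral_add (integrable_tri_dotProduct_mulVec (memLp_coords f) (memLp_coords g) hK)
      (integrable_tri_dotProduct_mulVec (memLp_coords g) (memLp_coords f) hK)]
    have e1 := h1 f g
    have e2 := h2 f g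
    have e3 := h2 g f
    rw [mul_comm ‖g‖] at e3
    rw [mul_assoc, add_mul, add_mul]
    exact (abs_add_le _ _).trans (add_le_add e1 ((abs_add_le _ _).trans (add_le_add e2 e3)))

end Form

/-- The block `diag(ε I, 0, 0)` acts only on the `f` component of the extended vector, so pointwise
positivity integrates to `ε ‖f‖²`. -/
lemma lyapunovForm_coercive {β d : ℕ} {ε : ℝ} {Tb : Matrix (Fin β) (Fin β) ℝ[X]}
    {T12 T13 : Matrix (Fin β) (Fin β × MonIdx d) ℝ[X]}
    {T22 T23 T33 : Matrix (Fin β × MonIdx d) (Fin β × MonIdx d) ℝ}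
    (hT22 : T22.IsSymm) (hT33 : T33.IsSymm)
    {ST : Matrix (Fin β ⊕ ((Fin β × MonIdx d) ⊕ (Fin β × MonIdx d)))
      (Fin β ⊕ ((Fin β × MonIdx d) ⊕ (Fin β × MonIdx d))) ℝ[X]}
    (hT : IsSOS (matT Tb T12 T13 T22 T23 T33 - matEps β d ε - omega • ST)) (hST : IsSOS ST)
    (f : L2 β) :
    ε * ‖f‖ ^ 2 ≤ lyapunovForm Tb (kernel T12 T13 T22 T23 T33) (fun x => (f x).ofLp)
      fun x => (f x).ofLp := by
  have hf := memLp_coords f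
  set u : ℝ → Fin β → ℝ := fun x => (f x).ofLp with hu
  set v : ℝ → Fin β ⊕ ((Fin β × MonIdx d) ⊕ (Fin β × MonIdx d)) → ℝ := fun x =>
    Sum.elim (u x) (Sum.elim (lowerIntegral d u x) (upperIntegral d u x)) with hv
  have hvL : MemLp v 2 μI := by
    refine memLp_pi_iff.2 fun i => ?_
    rcases i with i | i | i
    · exact hf.eval i
    · exact (memLp_lowerIntegral hf).eval i
    · exact (memLp_upperIntegral hf).eval i
  have hform : lyapunovForm Tb (kernel T12 T13 T22 T23 T33) u u
      = ∫ x, v x ⬝ᵥ evalMat (matT Tb T12 T13 T22 T23 T33) x *ᵥ v x ∂μI := by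
    have h := integral_blockMat_eq T12 T13 T22 T23 T33 Tb T12 T13 hf hf hT22 hT33
      (fun _ _ => rfl) fun _ _ => rfl
    refine Eq.trans ?_ h.symm
    simp only [lyapunovForm, ← two_mul, integral_const_mul]
  rw [hform, ← integral_norm_sq_eq, ← integral_const_mul]
  refine integral_mono_ae ((Lp.memLp f).integrable_norm_pow (by norm_num) |>.const_mul ε)
    (integrable_dotProduct_mulVec hvL hvL (continuous_evalMat _)) ?_
  filter_upwards [ae_mem_Icc] with x hx
  have h := dotProduct_nonneg_of_isSOS_sub hT hST hx (v x)
  have he : v x ⬝ᵥ evalMat (matEps β d ε) x *ᵥ v x = ε * ‖f x‖ ^ 2 := by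
    rw [hv, matEps, evalMat_fromBlocks, sumElim_dotProduct_fromBlocks]
    simp only [evalMat_real_smul, evalMat_one, evalMat_zero, smul_mulVec, one_mulVec, zero_mulVec,
      dotProduct_zero, dotProduct_smul, add_zero, smul_eq_mul, EuclideanSpace.norm_sq_eq,
      Real.norm_eq_abs, sq_abs]
    simp [dotProduct, hu, sq]
  rw [evalMat_sub, sub_mulVec, dotProduct_sub, he] at h
  exact sub_nonneg.1 h

end

end PolyPDE

/-! ### Exponential decay along solutions -/

theorem mainTheorem1 (α β d : ℕ) (ε δ : ℝ) (hε : 0 < ε) (hδ : 0 < δ)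
    (A : Matrix (Fin β) (JetIdx (α + 1) β) ℝ[X])
    (F : Matrix (JetIdx α β) (BdIdx α β) ℝ)
    -- the matrices defining `ℛ`
    (Rb : Matrix (BarIdx α β) (BarIdx α β) ℝ[X])
    (R12 R13 : Matrix (JetIdx (α + 1) β) (JetIdx (α + 1) β × MonIdx d) ℝ[X])
    (R22 R23 R33 : Matrix (JetIdx (α + 1) β × MonIdx d) (JetIdx (α + 1) β × MonIdx d) ℝ)
    (hRb : Rb.IsSymm) (hR22 : R22.IsSymm) (hR33 : R33.IsSymm)
    -- the matrices defining `𝒯`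
    (Tb : Matrix (Fin β) (Fin β) ℝ[X])
    (T12 T13 : Matrix (Fin β) (Fin β × MonIdx d) ℝ[X])
    (T22 T23 T33 : Matrix (Fin β × MonIdx d) (Fin β × MonIdx d) ℝ)
    (hTb : Tb.IsSymm) (hT22 : T22.IsSymm) (hT33 : T33.IsSymm)
    -- the multipliers
    (ST : Matrix (Fin β ⊕ ((Fin β × MonIdx d) ⊕ (Fin β × MonIdx d)))
      (Fin β ⊕ ((Fin β × MonIdx d) ⊕ (Fin β × MonIdx d))) ℝ[X])
    (SR : Matrix
      (BarIdx α β ⊕ ((JetIdx (α + 1) β × MonIdx d) ⊕ (JetIdx (α + 1) β × MonIdx d)))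
      (BarIdx α β ⊕ ((JetIdx (α + 1) β × MonIdx d) ⊕ (JetIdx (α + 1) β × MonIdx d))) ℝ[X])
    (S : Matrix (BarIdx α β) (BarIdx α β) ℝ[X])
    (hST : ST.IsSymm) (hSR : SR.IsSymm) (hS : S.IsSymm)
    -- the slack parameters
    (K1 : Matrix (JetIdx α β) (JetIdx α β) ℝ[X])
    (K2 : Matrix (JetIdx α β) (BdIdx α β) ℝ[X])
    (H1 H2 : Matrix (JetIdx α β) (JetIdx α β) (MvPolynomial (Fin 2) ℝ))
    (B1 : Matrix (JetIdx (α + 1) β) (JetIdx α β) ℝ[X])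
    (B2 : Matrix (BdIdx α β) (JetIdx α β) ℝ[X])
    -- the constraints
    (hT : IsSOS (matT Tb T12 T13 T22 T23 T33 - matEps β d ε - omega • ST))
    (hSTsos : IsSOS ST)
    (hR : IsSOS (matR Rb R12 R13 R22 R23 R33 - omega • SR))
    (hSRsos : IsSOS SR)
    (hP : IsSOS (He (matUb A δ Tb + matKb K1 K2 + matHb H1 H2 + matBb F B1 B2)
      - Rb - omega • S))
    (hSsos : IsSOS S)
    (hker : ∀ x y : ℝ, matUbar A δ (kernel T12 T13 T22 T23 T33) x y + matHbar H1 H2 x y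
      - kernel R12 R13 R22 R23 R33 x y = 0) :
    ExpStable A F δ := by
  have hK := continuous_kernel T12 T13 T22 T23 T33
  obtain ⟨q, hq⟩ := exists_lyapunovForm_continuous hTb hK
  have hlow : ∀ f : L2 β, ε * ‖f‖ ^ 2 ≤ q f f := fun f => by
    rw [hq]
    exact lyapunovForm_coercive hT22 hT33 hT hSTsos f
  -- The `+ 1` keeps `κ` positive even when `q = 0`, which happens for `β = 0`.
  have hup : ∀ f : L2 β, q f f ≤ (‖q‖ + 1) * ‖f‖ ^ 2 := fun f => by
    refine (le_abs_self _).trans ((q.le_opNorm₂ f f).trans ?_)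
    nlinarith [sq_nonneg ‖f‖]
  have hM : 0 < ‖q‖ + 1 := by positivity
  refine ⟨Real.sqrt ((‖q‖ + 1) / ε), Real.sqrt_pos.2 (by positivity), fun u hu t ht => ?_⟩
  -- along a solution, `exp (2 δ t) 𝒯(u t)` is nonincreasing
  have hanti : AntitoneOn (fun t => Real.exp (2 * δ * t) * q (u t) (u t)) (Ici 0) := by
    have hderiv : ∀ t, 0 < t → ∃ V' : ℝ, V' ≤ 0 ∧
        HasDerivAt (fun t => Real.exp (2 * δ * t) * q (u t) (u t)) V' t := by
      intro t ht
      obtain ⟨w, v, hw, huw, hv, hvw⟩ := hu.equation t ht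
      have hV : HasDerivAt (fun t => q (u t) (u t)) (q v (u t) + q (u t) v) t := by
        have h1 : HasDerivAt (fun t => q (u t)) (q v) t := q.hasFDerivAt.comp_hasDerivAt t hv
        exact h1.clm_apply hv
      have hE : HasDerivAt (fun t => Real.exp (2 * δ * t)) (Real.exp (2 * δ * t) * (2 * δ)) t := by
        simpa using ((hasDerivAt_id t).const_mul (2 * δ)).exp
      refine ⟨_, ?_, hE.mul hV⟩
      have hA : MemLp (fun x => evalMat A x *ᵥ jet (α + 1) w x) 2 μI := by
        refine (memLp_coords v).ae_eq ?_
        filter_upwards [hvw] with x hx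
        rw [hx]
      have hdiss := lyapunovForm_dissipation hR22 hR33 hK hR hSRsos hP hSsos hker hw hA
      have hu0 : ∀ᵐ x ∂μI, (u t x).ofLp = (dx 0 w x).ofLp := by
        filter_upwards [huw] with x hx
        simp only [hx, dx, iteratedDerivWithin_zero]
      have hv0 : ∀ᵐ x ∂μI, (v x).ofLp = evalMat A x *ᵥ jet (α + 1) w x := by
        filter_upwards [hvw] with x hx
        rw [hx]
      rw [← lyapunovForm_congr hu0 hv0, ← lyapunovForm_congr hu0 hu0, ← hq, ← hq] at hdiss
      -- Symmetry merges the two terms of `V'` into `2 q(u, v)`, twice the quantity controlled by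
      -- `hdiss`.
      have hsymm : q v (u t) = q (u t) v := by
        rw [hq, hq, lyapunovForm_comm hTb]
      rw [hsymm]
      have := mul_nonpos_of_nonneg_of_nonpos (Real.exp_pos (2 * δ * t)).le hdiss
      linarith
    have hqc : Continuous fun f : L2 β => q f f := by fun_prop
    -- The equation holds only for `t > 0`; continuity of `u` in `L₂` carries monotonicity down to
    -- `t = 0`.
    refine antitoneOn_of_deriv_nonpos (convex_Ici 0) ?_ ?_ ?_
    · exact (Continuous.continuousOn (by fun_prop)).mul (hqc.comp_continuousOn hu.continuousOn)
    · intro s hs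
      rw [interior_Ici] at hs
      obtain ⟨_, _, h⟩ := hderiv s hs
      exact h.differentiableAt.differentiableWithinAt
    · intro s hs
      rw [interior_Ici] at hs
      obtain ⟨_, h0, h⟩ := hderiv s hs
      rwa [h.deriv]
  have h1 := hanti (mem_Ici.2 le_rfl) (mem_Ici.2 ht) ht
  simp only [mul_zero, Real.exp_zero, one_mul] at h1
  -- Coercivity is used at time `t` and the upper bound at time `0`.
  have h2 : ε * (Real.exp (δ * t) * ‖u t‖) ^ 2 ≤ (‖q‖ + 1) * ‖u 0‖ ^ 2 := by
    refine le_trans ?_ (h1.trans (hup _))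
    have h3 : Real.exp (2 * δ * t) = Real.exp (δ * t) ^ 2 := by
      rw [← Real.exp_nat_mul]
      congr 1
      push_cast
      ring
    rw [h3, mul_pow]
    have := mul_le_mul_of_nonneg_left (hlow (u t)) (sq_nonneg (Real.exp (δ * t)))
    linarith
  have h4 : Real.exp (δ * t) * ‖u t‖ ≤ Real.sqrt ((‖q‖ + 1) / ε) * ‖u 0‖ := by
    rw [← Real.sqrt_sq (norm_nonneg (u 0)), ← Real.sqrt_mul (by positivity)]
    refine Real.le_sqrt_of_sq_le ?_
    rw [div_mul_eq_mul_div, le_div_iff₀ hε]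
    linarith
  calc ‖u t‖ = Real.exp (-δ * t) * (Real.exp (δ * t) * ‖u t‖) := by
        rw [← mul_assoc, ← Real.exp_add]
        simp
    _ ≤ Real.exp (-δ * t) * (Real.sqrt ((‖q‖ + 1) / ε) * ‖u 0‖) := by gcongr
    _ = Real.sqrt ((‖q‖ + 1) / ε) * Real.exp (-δ * t) * ‖u 0‖ := by ring
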